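/- **Geometry of cyclidic patches.** A (Dupin) cyclide in $\mathbb R^3\cup\{\infty\}$, not a circle, is given by two mutually polar subspaces $P^{(1)},P^{(2)}$ of signature $(++-)$ of the space $\mathbb R^{4,2}$ of homogeneous Lie coordinates; the isotropic points of $P^{(1)}$ and of $P^{(2)}$ are the two one-parameter families of oriented spheres (proper spheres, planes or points) enveloping the cyclide. Every sphere of one family is in oriented contact with every sphere of the other. Parametrizing both families by their standard quadratic parametrizations $s^{(1)}(u)$, $s^{(2)}(v)$ through three distinct reference spheres, let $f(u,v)$ be the point of contact of $s^{(1)}(u)$ and $s^{(2)}(v)$ and $n(u,v)$ their common oriented unit normal there. A cyclidic patch is the restriction of $f$ to a closed rectangle $[u_0,u_1]\times[v_0,v_1]$, with vertices $$x=f(u_0,v_0),\quad x_1=f(u_1,v_0),\quad x_{12}=f(u_1,v_1),\quad x_2=f(u_0,v_1).$$ Assume that the four vertices are finite points. Then: (i) The four vertices lie on a generalized circle (a circle or a straight line). (ii) Assume moreover that the vertices are non-singular points of the cyclide, i.e. that no point sphere of one of the two families is a vertex. Then the vertices are distinct, and at each vertex the vertex frame $(t^{(1)},t^{(2)},n)$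 is orthonormal, where $t^{(1)}$ and $t^{(2)}$ are the unit tangent vectors at this vertex of the two boundary arcs of the patch starting there (along $u$ and along $v$, respectively), directed from this vertex into the arc, and $n$ is the oriented normal of the cyclide. Let $y,y'$ be vertices which are neighbours in direction $i\in\{1,2\}$ (direction $1$: the pairs $x,x_1$ and $x_2,x_{12}$; direction $2$: the pairs $x,x_2$ and $x_1,x_{12}$), let $z,z'$ be the other two vertices, let $B,B'$ be the vertex frames at $y,y'$, let $\{i,j\}=\{1,2\}$, let $\delta=y'-y$, let $$H(w)=w-2\,\frac{\langle\delta,w\rangle}{\langle\delta,\delta\rangle}\,\delta$$ be the action on vectors of the reflection in the perpendicular bisecting plane of $[y,y']$, and let $F^{(j)}$ be the map $t^{(j)}\mapsto -t^{(j)}$ on frames, which keeps the other two vectors. * If $y,y'$ are not separated by $z,z'$ on the generalized circle through the vertices, then $B'=H(B)$. * If $y,y'$ are separated by $z,z'$, then $B'=H(F^{(j)}(B))=F^{(j)}(H(B))$. Consequently, if the vertex quadrilateral $(x,x_1,x_{12},x_2)$ is embedded (no side crosses its opposite side, i.e. the end points of no side are separated on the generalized circle by those of the opposite side), then $B'=H(B)$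 along all four sides. If it is not embedded, the additional reversal $F^{(j)}$ occurs along both sides of exactly one pair of opposite sides and not along the other two sides. Finally, let $s$ be the boundary sphere containing the boundary arc from $y$ to $y'$, i.e. the enveloping sphere touching the cyclide along this arc. If $s$ is a proper sphere, the normal lines of the cyclide at $y$ and $y'$ both pass through the centre of $s$, and this is their only common point unless the two lines coincide. If $s$ is a plane, the normals at $y$ and $y'$ are equal (the normal lines are parallel). -/

import Mathlib

namespace Cyclidic

/-- Euclidean three-space. -/
abbrev E3 : Type := EuclideanSpace ℝ (Fin 3)

/-- The space `ℝ^{4,2}` of homogeneous Lie coordinates, written in the basis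
`(e₁, e₂, e₃, e₀, e_∞, e_r)`: the entries are the Euclidean part, the `e₀`-component,
the `e_∞`-component and the `e_r`-component. -/
abbrev LieSpace : Type := E3 × ℝ × ℝ × ℝ

/-- The Euclidean part of a Lie vector. -/
def pos (s : LieSpace) : E3 := s.1

/-- The `e₀`-component; it vanishes exactly for hyperplanes and for the point `∞`. -/
def c0 (s : LieSpace) : ℝ := s.2.1

/-- The `e_∞`-component. -/
def cInf (s : LieSpace) : ℝ := s.2.2.1

/-- The `e_r`-component; it vanishes exactly for point spheres. -/
def cr (s : LieSpace) : ℝ := s.2.2.2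

/-- The Lie inner product of signature `(4,2)`: in the basis above
`⟨e_i, e_i⟩ = 1` for `i = 1, 2, 3`, `⟨e₀, e_∞⟩ = -1/2`, `⟨e_r, e_r⟩ = -1`, and all other
products of basis vectors vanish. -/
noncomputable def lieForm : LinearMap.BilinForm ℝ LieSpace :=
  LinearMap.mk₂ ℝ
    (fun s w => inner ℝ (pos s) (pos w) - (c0 s * cInf w + cInf s * c0 w) / 2 - cr s * cr w)
    (by intro s s' w; simp only [pos, c0, cInf, cr, Prod.fst_add, Prod.snd_add, inner_add_left]; ring)
    (by
      intro c s w
      simp only [pos, c0, cInf, cr, Prod.smul_fst, Prod.smul_snd, real_inner_smul_left, smul_eq_mul]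
      ring)
    (by intro s w w'; simp only [pos, c0, cInf, cr, Prod.fst_add, Prod.snd_add, inner_add_right]; ring)
    (by
      intro c s w
      simp only [pos, c0, cInf, cr, Prod.smul_fst, Prod.smul_snd, real_inner_smul_right, smul_eq_mul]
      ring)

/-- A nonzero isotropic vector, i.e. homogeneous coordinates of a generalized oriented sphere
(proper oriented sphere, oriented plane, or point, including `∞`). -/
def IsSphereVec (s : LieSpace) : Prop := s ≠ 0 ∧ lieForm s s = 0

/-- A projective plane of signature `(++-)`, as a linear subspace: it is spanned by three
pairwise orthogonal vectors whose squares are `1, 1, -1`. -/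
def IsCyclidicPlane (P : Submodule ℝ LieSpace) : Prop :=
  ∃ w : Fin 3 → LieSpace, P = Submodule.span ℝ (Set.range w) ∧
    ∀ k l, lieForm (w k) (w l) = if k = l then (![1, 1, -1] : Fin 3 → ℝ) k else 0

/-- A Dupin cyclide: a decomposition of `ℝ^{4,2}` into two polar planes of signature `(++-)`.
The spheres of the two enveloping families are the isotropic points of the two planes.
The last two conditions exclude circles, for which one family consists of point spheres only. -/
structure DupinCyclide where
  P₁ : Submodule ℝ LieSpace
  P₂ : Submodule ℝ LieSpace
  cyclidic₁ : IsCyclidicPlane P₁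
  cyclidic₂ : IsCyclidicPlane P₂
  polar : P₂ = lieForm.orthogonal P₁
  not_circle₁ : ∃ s ∈ P₁, cr s ≠ 0
  not_circle₂ : ∃ s ∈ P₂, cr s ≠ 0

/-- Three (homogeneous coordinates of) distinct spheres of the cyclidic family with plane `P`. -/
def IsSphereTriple (P : Submodule ℝ LieSpace) (s : Fin 3 → LieSpace) : Prop :=
  (∀ k, s k ∈ P ∧ IsSphereVec (s k)) ∧ ∀ k l, k ≠ l → LinearIndependent ℝ ![s k, s l]

/-- The quadratic parametrization of a cyclidic family of spheres which passes through the
spheres `s 0, s 1, s 2` at the parameters `0, 1/2, 1`. -/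
noncomputable def familyParam (s : Fin 3 → LieSpace) (t : ℝ) : LieSpace :=
  (lieForm (s 1) (s 2) * (2 * t ^ 2 - 3 * t + 1)) • s 0
    + (lieForm (s 0) (s 2) * (t - t ^ 2)) • s 1
    + (lieForm (s 0) (s 1) * (2 * t ^ 2 - t)) • s 2

/-- Homogeneous coordinates of the point sphere of the contact element spanned by `s` and `w`,
i.e. of their point of contact. -/
def contactVec (s w : LieSpace) : LieSpace := cr w • s - cr s • w

/-- The Euclidean point of contact of `s` and `w`: the `e₀`-component of the point sphere is
normalized to `1`. (A meaningful value only if the point of contact is not `∞`, i.e. if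
`c0 (contactVec s w) ≠ 0`.) -/
noncomputable def contactPoint (s w : LieSpace) : E3 :=
  (c0 (contactVec s w))⁻¹ • pos (contactVec s w)

/-- The unit normal of the contact element spanned by `s` and `w`: the Euclidean part of the unique
vector in the span of `s` and `w` with `e₀`-component `0` and `e_r`-component `1`, which represents
the oriented tangent plane. (A meaningful value only if the point of contact is not `∞`.)
For a proper sphere of radius `r > 0` this is the inward normal. -/
noncomputable def contactNormal (s w : LieSpace) : E3 :=
  (c0 (contactVec s w))⁻¹ • pos (c0 s • w - c0 w • s)

/-- The centre of a proper sphere (`c0 s ≠ 0`). -/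
noncomputable def center (s : LieSpace) : E3 := (c0 s)⁻¹ • pos s

/-- A cyclidic patch: the restriction of a curvature line parametrization of a Dupin cyclide to a
closed rectangle `[u false, u true] × [v false, v true]`. The parametrization is given by three
distinct reference spheres in each of the two enveloping families. -/
structure Patch where
  cyclide : DupinCyclide
  s₁ : Fin 3 → LieSpace
  s₂ : Fin 3 → LieSpace
  triple₁ : IsSphereTriple cyclide.P₁ s₁
  triple₂ : IsSphereTriple cyclide.P₂ s₂
  u : Bool → ℝ
  v : Bool → ℝ
  u_lt : u false < u true
  v_lt : v false < v true

namespace Patch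

variable (F : Patch)

/-- The enveloping sphere of the first family at parameter `t`. It touches the cyclide along the
parameter line `{t} × ℝ`. -/
noncomputable def sphere₁ (t : ℝ) : LieSpace := familyParam F.s₁ t

/-- The enveloping sphere of the second family at parameter `t`. It touches the cyclide along the
parameter line `ℝ × {t}`. -/
noncomputable def sphere₂ (t : ℝ) : LieSpace := familyParam F.s₂ t

/-- The Euclidean curvature line parametrization. -/
noncomputable def f (p q : ℝ) : E3 := contactPoint (F.sphere₁ p) (F.sphere₂ q)

/-- The unit normal field of the oriented cyclide. -/
noncomputable def normal (p q : ℝ) : E3 := contactNormal (F.sphere₁ p) (F.sphere₂ q)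

/-- The vertices: `x = vertex false false`, `x₁ = vertex true false`, `x₁₂ = vertex true true`,
`x₂ = vertex false true`. -/
noncomputable def vertex (i j : Bool) : E3 := F.f (F.u i) (F.v j)

/-- No vertex of the patch is the point `∞`. -/
def FiniteVertices : Prop :=
  ∀ i j, c0 (contactVec (F.sphere₁ (F.u i)) (F.sphere₂ (F.v j))) ≠ 0

/-- No vertex is a singular point of the cyclide. A singular point is a point of the cyclide which
is a point sphere of one of the two enveloping families. -/
def NonsingularVertices : Prop :=
  ∀ i j, cr (F.sphere₁ (F.u i)) ≠ 0 ∧ cr (F.sphere₂ (F.v j)) ≠ 0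

/-- The boundary sphere supporting the boundary arc between `vertex false j` and `vertex true j`. -/
noncomputable def boundarySphere₁ (j : Bool) : LieSpace := F.sphere₂ (F.v j)

/-- The boundary sphere supporting the boundary arc between `vertex i false` and `vertex i true`. -/
noncomputable def boundarySphere₂ (i : Bool) : LieSpace := F.sphere₁ (F.u i)

/-- The unit vector in direction of `w`. -/
noncomputable def unit (w : E3) : E3 := ‖w‖⁻¹ • w

/-- `1` at the initial and `-1` at the terminal point of a parameter interval: tangent vectors of
boundary arcs at a vertex point from this vertex into the arc. -/
def inward (i : Bool) : ℝ := if i then -1 else 1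

/-- The unit tangent vector at `vertex i j` of the boundary arc from `vertex i j` to
`vertex (!i) j`, pointing into the arc. -/
noncomputable def tangent₁ (i j : Bool) : E3 :=
  inward i • unit (deriv (fun p => F.f p (F.v j)) (F.u i))

/-- The unit tangent vector at `vertex i j` of the boundary arc from `vertex i j` to
`vertex i (!j)`, pointing into the arc. -/
noncomputable def tangent₂ (i j : Bool) : E3 :=
  inward j • unit (deriv (fun q => F.f (F.u i) q) (F.v j))

/-- The normal of the cyclide at `vertex i j`. -/
noncomputable def vertexNormal (i j : Bool) : E3 := F.normal (F.u i) (F.v j)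

/-- The vertex frame `(t⁽¹⁾, t⁽²⁾, n)` at `vertex i j`. -/
noncomputable def frame (i j : Bool) : Fin 3 → E3 :=
  ![F.tangent₁ i j, F.tangent₂ i j, F.vertexNormal i j]

/-- The normal line at `vertex i j`. -/
noncomputable def normalLine (i j : Bool) : AffineSubspace ℝ E3 :=
  AffineSubspace.mk' (F.vertex i j) (Submodule.span ℝ {F.vertexNormal i j})

end Patch

/-- The action on vectors of the reflection in the perpendicular bisecting plane of `[x, y]`,
applied to each vector of a frame. -/
noncomputable def reflectFrame (x y : E3) (B : Fin 3 → E3) : Fin 3 → E3 :=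
  fun k => B k - (2 * (inner ℝ (y - x) (B k) / inner ℝ (y - x) (y - x))) • (y - x)

/-- Reversal of `t⁽¹⁾` in `(t⁽¹⁾, t⁽²⁾, n)`. -/
def flip₁ (B : Fin 3 → E3) : Fin 3 → E3 := ![-B 0, B 1, B 2]

/-- Reversal of `t⁽²⁾` in `(t⁽¹⁾, t⁽²⁾, n)`. -/
def flip₂ (B : Fin 3 → E3) : Fin 3 → E3 := ![B 0, -B 1, B 2]

/-- The points of `S` lie on a generalized circle, i.e. on a circle or on a straight line. -/
def Concircular (S : Set E3) : Prop :=
  EuclideanGeometry.Concyclic S ∨ Collinear ℝ S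

/-- For four distinct points on a generalized circle: `a, b` are separated by `c, d`.
On a proper circle this means that `c` and `d` lie strictly on different sides of the
line `ab`, i.e. on different arcs between `a` and `b`. On a straight line (a circle through `∞`)
it means that exactly one of `c` and `d` lies strictly between `a` and `b`. -/
def Separated (a b c d : E3) : Prop :=
  (Collinear ℝ {a, b, c, d} ∧ Xor (Sbtw ℝ a c b) (Sbtw ℝ a d b)) ∨
    (¬ Collinear ℝ {a, b, c, d} ∧ (line[ℝ, a, b]).SOppSide c d)

/-- For four distinct points on a generalized circle: the quadrilateral with consecutive vertices
`a, b, c, d` is embedded, i.e. no side crosses its opposite side (the end points of no side are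
separated by the end points of the opposite side). -/
def EmbeddedQuad (a b c d : E3) : Prop :=
  ¬ Separated a b c d ∧ ¬ Separated b c d a

end Cyclidic

open Cyclidic

/-! Write s_i and w_j for the boundary spheres of the two families. The vertex x_ij has the Lie
coordinates cr(w_j) s_i − cr(s_i) w_j = c_ij · `pointVec` x_ij. Eliminating the spheres from these
four vectors leaves one linear relation between the points, with weights ± cr(s_i') cr(w_j') c_ij,
where a prime denotes the other index (`ContactGrid.liftRelation`). Together with their squared
norms the vertices are thus linearly dependent, which is concircularity
(`LiftRelation.concircular`). If a boundary sphere is a point, two vertices coincide and only three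
points remain.

For nonsingular vertices, two neighbours are separated by the other two exactly when their weights
have equal sign (`LiftRelation.separated_iff`). The factors c_ij all have the same sign
(`c_mul_c_pos`), so neighbours in direction 1 are separated iff cr(s_0) cr(s_1) < 0, and similarly
in direction 2. The weights sum to zero, so both pairs of opposite sides cannot be affected at once
(`not_both_neg`).

For the frames, let b be the polar form of the first quadratic parametrization at (u_0, u_1), and d
that of the second at (v_0, v_1). Both are orthogonal to all four boundary spheres, and modulo each
contact element they represent the two tangent directions (`hasDerivAt_contactPoint`). Since the
same b and d serve at all vertices, the reflection exchanging two neighbours carries their tangent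
parts and normals to one another (`FiniteContact.reflectVec_tangentPart`,
`FiniteContact.reflectVec_normal`). Only signs remain: the inward tangents are positive multiples of
cr(w_j)/c_ij and −cr(s_i)/c_ij times the tangent parts of b and d. Along direction 1 the former sign
is constant, while the latter changes exactly when cr(s_0) cr(s_1) < 0, which is the separation
criterion. -/

namespace Cyclidic

/-! ### Dependent Möbius lifts: concircularity and separation. -/

/-- The points `a, b, c, d` with weights `p, q, r, t` are in linear dependence together with their
squared norms, i.e. their lifts to the light cone of Möbius geometry are linearly dependent. -/
structure LiftRelation (a b c d : E3) (p q r t : ℝ) : Prop where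
  sum_weights : p + q + r + t = 0
  sum_smul : p • a + q • b + r • c + t • d = 0
  sum_sq : p * inner ℝ a a + q * inner ℝ b b + r * inner ℝ c c + t * inner ℝ d d = 0

namespace LiftRelation

variable {a b c d : E3} {p q r t : ℝ}

lemma sum_inner (h : LiftRelation a b c d p q r t) (y : E3) :
    p * inner ℝ a y + q * inner ℝ b y + r * inner ℝ c y + t * inner ℝ d y = 0 := by
  have := congrArg (fun z => inner ℝ z y) h.sum_smul
  simpa only [inner_add_left, real_inner_smul_left, inner_zero_left] using this

lemma sum_mul_inner_sub_sub (h : LiftRelation a b c d p q r t) (y z : E3) :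
    p * inner ℝ (a - y) (a - z) + q * inner ℝ (b - y) (b - z) + r * inner ℝ (c - y) (c - z)
      + t * inner ℝ (d - y) (d - z) = 0 := by
  simp only [inner_sub_left, inner_sub_right, real_inner_comm _ y]
  linear_combination h.sum_sq - h.sum_inner y - h.sum_inner z + inner ℝ z y * h.sum_weights

/-- With hats denoting lifts, p â + q b̂ = −(r ĉ + t d̂); lifts are isotropic, so taking squares
leaves only the mixed products, which are −|a − b|²/2 and −|c − d|²/2. It shows that pq and rt have
the same sign. -/
lemma mul_mul_inner_sub_self (h : LiftRelation a b c d p q r t) :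
    p * q * inner ℝ (a - b) (a - b) = r * t * inner ℝ (c - d) (c - d) := by
  have h1 := h.sum_inner a
  have h2 := h.sum_inner b
  have h3 := h.sum_inner c
  have h4 := h.sum_inner d
  simp only [inner_sub_left, inner_sub_right, real_inner_comm b a, real_inner_comm c a,
    real_inner_comm d a, real_inner_comm c b, real_inner_comm d b, real_inner_comm d c] at *
  have hw := h.sum_weights
  have hs := h.sum_sq
  linear_combination (p + q) * hs - p * h1 - q * h2 + r * h3 + t * h4 -
    (r * inner ℝ c c + t * inner ℝ d d) * hw

lemma eq_combination (h : LiftRelation a b c d p q r t) (ht : t ≠ 0) :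
    d = (-r / t) • (c - a) + ((-q / t) • (b - a) + a) := by
  have hp : p = -(q + r + t) := by linear_combination h.sum_weights
  have h1 := h.sum_smul
  rw [hp] at h1
  have h2 : t • d = t • ((-r / t) • (c - a) + ((-q / t) • (b - a) + a)) := by
    rw [smul_add, smul_add, smul_smul, smul_smul, mul_div_cancel₀ _ ht, mul_div_cancel₀ _ ht]
    rw [← sub_eq_zero, ← h1]
    module
  exact smul_right_injective _ ht h2

end LiftRelation

lemma cospherical_or_collinear_triple (a b c : E3) :
    EuclideanGeometry.Cospherical {a, b, c} ∨ Collinear ℝ {a, b, c} := by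
  by_cases h : Collinear ℝ {a, b, c}
  · exact Or.inr h
  · left
    let T : Affine.Triangle ℝ E3 := ⟨![a, b, c], affineIndependent_iff_not_collinear_set.2 h⟩
    refine ⟨T.circumcenter, T.circumradius, ?_⟩
    rintro x (rfl | rfl | rfl)
    · exact T.dist_circumcenter_eq_circumradius 0
    · exact T.dist_circumcenter_eq_circumradius 1
    · exact T.dist_circumcenter_eq_circumradius 2

lemma concircular_triple (a b c : E3) : Concircular {a, b, c} :=
  (cospherical_or_collinear_triple a b c).imp (fun h => ⟨h, coplanar_triple ℝ a b c⟩) id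

/-- The relation places d in the affine span of a, b, c. If a, b, c lie on a sphere about y, the
weighted sum of squared distances to y forces d onto the same sphere. -/
lemma LiftRelation.concircular {a b c d : E3} {p q r t : ℝ} (h : LiftRelation a b c d p q r t)
    (ht : t ≠ 0) : Concircular {d, a, b, c} := by
  have hd : d ∈ affineSpan ℝ ({a, b, c} : Set E3) := by
    have ha : a ∈ affineSpan ℝ ({a, b, c} : Set E3) := mem_affineSpan ℝ (by simp)
    have hb : b ∈ affineSpan ℝ ({a, b, c} : Set E3) := mem_affineSpan ℝ (by simp)
    have hc : c ∈ affineSpan ℝ ({a, b, c} : Set E3) := mem_affineSpan ℝ (by simp)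
    rw [h.eq_combination ht]
    exact AffineSubspace.smul_vsub_vadd_mem _ _ hc ha
      (AffineSubspace.smul_vsub_vadd_mem _ _ hb ha ha)
  rcases cospherical_or_collinear_triple a b c with ⟨y, R, hy⟩ | hcol
  · left
    refine ⟨⟨y, R, ?_⟩, (coplanar_insert_iff_of_mem_affineSpan hd).2 (coplanar_triple ℝ a b c)⟩
    have ha := hy a (by simp)
    have hb := hy b (by simp)
    have hc := hy c (by simp)
    have hR : 0 ≤ R := ha ▸ dist_nonneg
    rintro x (rfl | hx)
    · have hsum := h.sum_mul_inner_sub_sub y y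
      simp only [real_inner_self_eq_norm_sq, ← dist_eq_norm, ha, hb, hc] at hsum
      have : t * (dist x y ^ 2 - R ^ 2) = 0 := by
        linear_combination hsum - R ^ 2 * h.sum_weights
      have h2 : dist x y ^ 2 = R ^ 2 :=
        sub_eq_zero.1 ((mul_eq_zero.1 this).resolve_left ht)
      exact (sq_eq_sq₀ dist_nonneg hR).1 h2
    · exact hy x hx
  · exact Or.inr ((collinear_insert_iff_of_mem_affineSpan hd).2 hcol)

lemma xor_mem_Ioo_iff {θ φ p q : ℝ} (hq : q ≠ 0)
    (hθ : θ ≠ 0) (hθ1 : θ ≠ 1) (hφ : φ ≠ 0) (hφ1 : φ ≠ 1)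
    (h : p * (θ * φ) + q * ((1 - θ) * (1 - φ)) = 0) :
    Xor (θ ∈ Set.Ioo (0 : ℝ) 1) (φ ∈ Set.Ioo (0 : ℝ) 1) ↔ 0 < p * q := by
  have key : p * q * (θ * φ) ^ 2 = -(q ^ 2 * ((θ * (1 - θ)) * (φ * (1 - φ)))) := by
    linear_combination q * θ * φ * h
  have hpos : 0 < (θ * φ) ^ 2 := by positivity
  have hq2 : 0 < q ^ 2 := by positivity
  have mem (x : ℝ) : x ∈ Set.Ioo (0 : ℝ) 1 ↔ 0 < x * (1 - x) := by
    constructor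
    · rintro ⟨h0, h1⟩
      exact mul_pos h0 (by linarith)
    · intro hx
      constructor <;> nlinarith
  have h1 : 0 < p * q ↔ (θ * (1 - θ)) * (φ * (1 - φ)) < 0 := by
    rw [← mul_pos_iff_of_pos_right hpos, key, ← mul_neg, mul_pos_iff_of_pos_left hq2, neg_pos]
  have hne : θ * (1 - θ) ≠ 0 := mul_ne_zero hθ (sub_ne_zero.2 hθ1.symm)
  have hne' : φ * (1 - φ) ≠ 0 := mul_ne_zero hφ (sub_ne_zero.2 hφ1.symm)
  rw [h1, mem, mem, mul_neg_iff, xor_def, not_lt, not_lt, hne.le_iff_lt, hne'.le_iff_lt]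
  tauto

/-- Among four distinct points with dependent lifts, two of them are separated by the other two
if and only if their weights have the same sign. -/
lemma LiftRelation.separated_iff {a b c d : E3} {p q r t : ℝ} (h : LiftRelation a b c d p q r t)
    (hq : q ≠ 0) (hr : r ≠ 0) (ht : t ≠ 0) (hab : a ≠ b) (hac : a ≠ c)
    (had : a ≠ d) (hbc : b ≠ c) (hbd : b ≠ d) (hcd : c ≠ d) :
    Separated a b c d ↔ 0 < p * q := by
  have hpos {x y : E3} (hxy : x ≠ y) : 0 < inner ℝ (x - y) (x - y) :=
    real_inner_self_pos.2 (sub_ne_zero.2 hxy)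
  by_cases hcol : Collinear ℝ {a, b, c, d}
  · have hc := hcol.mem_affineSpan_of_mem_of_ne (p₁ := a) (p₂ := b) (p₃ := c)
      (by simp) (by simp) (by simp) hab
    have hd := hcol.mem_affineSpan_of_mem_of_ne (p₁ := a) (p₂ := b) (p₃ := d)
      (by simp) (by simp) (by simp) hab
    obtain ⟨θ, rfl⟩ := mem_affineSpan_pair_iff_exists_lineMap_eq.1 hc
    obtain ⟨φ, rfl⟩ := mem_affineSpan_pair_iff_exists_lineMap_eq.1 hd
    have hsep : Separated a b (AffineMap.lineMap a b θ) (AffineMap.lineMap a b φ) ↔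
        Xor (θ ∈ Set.Ioo (0 : ℝ) 1) (φ ∈ Set.Ioo (0 : ℝ) 1) := by
      simp only [Separated, hcol, not_true_eq_false, false_and, or_false, true_and,
        sbtw_lineMap_iff, ne_eq, hab, not_false_eq_true]
    rw [hsep]
    have hl (s : ℝ) : AffineMap.lineMap a b s = s • (b - a) + a := rfl
    apply xor_mem_Ioo_iff hq
    · rintro rfl; simp at hac
    · rintro rfl; simp at hbc
    · rintro rfl; simp at had
    · rintro rfl; simp at hbd
    -- Basing the inner products at the third and fourth points kills their two terms; what is left
    -- is a relation between the line parameters θ and φ.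
    · have hs := h.sum_mul_inner_sub_sub (AffineMap.lineMap a b θ) (AffineMap.lineMap a b φ)
      simp only [sub_self, inner_zero_left, inner_zero_right, mul_zero, add_zero] at hs
      have e1 (s : ℝ) : a - AffineMap.lineMap a b s = (-s) • (b - a) := by rw [hl]; module
      have e2 (s : ℝ) : b - AffineMap.lineMap a b s = (1 - s) • (b - a) := by rw [hl]; module
      simp only [e1, e2, real_inner_smul_left, real_inner_smul_right] at hs
      have hne := (hpos hab.symm).ne'
      apply mul_right_cancel₀ hne
      linear_combination hs
  · have hsep : Separated a b c d ↔ (line[ℝ, a, b]).SOppSide c d := by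
      simp [Separated, hcol]
    have heq := h.eq_combination ht
    have ha : a ∈ line[ℝ, a, b] := left_mem_affineSpan_pair ℝ a b
    have hb : b ∈ line[ℝ, a, b] := right_mem_affineSpan_pair ℝ a b
    have hy : (-q / t) • (b - a) + a ∈ line[ℝ, a, b] :=
      AffineSubspace.smul_vsub_vadd_mem _ _ hb ha ha
    have hc : c ∉ line[ℝ, a, b] := by
      intro hc
      have hd : d ∈ line[ℝ, a, b] := by
        rw [heq]
        exact AffineSubspace.smul_vsub_vadd_mem _ _ hc ha hy
      apply hcol
      have := collinear_insert_insert_of_mem_affineSpan_pair hc hd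
      refine this.subset ?_
      intro x
      simp only [Set.mem_insert_iff, Set.mem_singleton_iff]
      tauto
    -- Off a common line, the side of d relative to ab is the sign of its coefficient −r/t along c −
    -- a.
    have hrt : 0 < p * q ↔ 0 < r * t := by
      rw [← mul_pos_iff_of_pos_right (hpos hab), h.mul_mul_inner_sub_self,
        mul_pos_iff_of_pos_right (hpos hcd)]
    have hdiv : -r / t = -(r * t) / t ^ 2 := by field_simp
    have ht2 : 0 < t ^ 2 := by positivity
    rw [hsep, hrt]
    constructor
    · intro hopp
      by_contra hneg
      have hneg' : r * t < 0 := lt_of_le_of_ne (not_lt.1 hneg) (mul_ne_zero hr ht)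
      have hpos' : 0 < -r / t := by
        rw [hdiv]
        exact div_pos (neg_pos.2 hneg') ht2
      have hs := AffineSubspace.sSameSide_smul_vsub_vadd_left hc ha hy hpos'
      rw [vsub_eq_sub, vadd_eq_add, ← heq] at hs
      exact hs.not_sOppSide hopp.symm
    · intro hlt
      have hneg : -r / t < 0 := by
        rw [hdiv]
        exact div_neg_of_neg_of_pos (neg_lt_zero.2 hlt) ht2
      have hs := AffineSubspace.sOppSide_smul_vsub_vadd_left hc ha hy hneg
      rw [vsub_eq_sub, vadd_eq_add, ← heq] at hs
      exact hs.symm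

/-! ### Contact elements in Lie coordinates. -/

lemma lieForm_apply (s w : LieSpace) :
    lieForm s w =
      inner ℝ (pos s) (pos w) - (c0 s * cInf w + cInf s * c0 w) / 2 - cr s * cr w := rfl

lemma lieForm_comm (s w : LieSpace) : lieForm s w = lieForm w s := by
  rw [lieForm_apply, lieForm_apply, real_inner_comm]
  ring

@[simp] lemma pos_add (s w : LieSpace) : pos (s + w) = pos s + pos w := rfl
@[simp] lemma pos_sub (s w : LieSpace) : pos (s - w) = pos s - pos w := rfl
@[simp] lemma pos_smul (r : ℝ) (s : LieSpace) : pos (r • s) = r • pos s := rfl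
@[simp] lemma c0_add (s w : LieSpace) : c0 (s + w) = c0 s + c0 w := rfl
@[simp] lemma c0_sub (s w : LieSpace) : c0 (s - w) = c0 s - c0 w := rfl
@[simp] lemma c0_smul (r : ℝ) (s : LieSpace) : c0 (r • s) = r * c0 s := rfl
@[simp] lemma cInf_add (s w : LieSpace) : cInf (s + w) = cInf s + cInf w := rfl
@[simp] lemma cInf_smul (r : ℝ) (s : LieSpace) : cInf (r • s) = r * cInf s := rfl
@[simp] lemma cr_sub (s w : LieSpace) : cr (s - w) = cr s - cr w := rfl
@[simp] lemma cr_smul (r : ℝ) (s : LieSpace) : cr (r • s) = r * cr s := rfl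

@[simp] lemma pos_neg (s : LieSpace) : pos (-s) = -pos s := rfl
@[simp] lemma c0_neg (s : LieSpace) : c0 (-s) = -c0 s := rfl
@[simp] lemma cInf_neg (s : LieSpace) : cInf (-s) = -cInf s := rfl
@[simp] lemma pos_zero : pos 0 = 0 := rfl
@[simp] lemma c0_zero : c0 0 = 0 := rfl
@[simp] lemma cInf_zero : cInf 0 = 0 := rfl

lemma lieSpace_ext {s w : LieSpace} (h1 : pos s = pos w) (h2 : c0 s = c0 w)
    (h3 : cInf s = cInf w) (h4 : cr s = cr w) : s = w :=
  Prod.ext h1 (Prod.ext h2 (Prod.ext h3 h4))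

/-- Homogeneous coordinates of the point `x`. -/
noncomputable def pointVec (x : E3) : LieSpace := (x, 1, inner ℝ x x, 0)

/-- Homogeneous coordinates of the oriented plane through `x` with unit normal `n`. -/
noncomputable def planeVec (x n : E3) : LieSpace := (n, 0, 2 * inner ℝ x n, 1)

@[simp] lemma pos_pointVec (x : E3) : pos (pointVec x) = x := rfl
@[simp] lemma c0_pointVec (x : E3) : c0 (pointVec x) = 1 := rfl
@[simp] lemma cInf_pointVec (x : E3) : cInf (pointVec x) = inner ℝ x x := rfl
@[simp] lemma cr_pointVec (x : E3) : cr (pointVec x) = 0 := rfl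
@[simp] lemma pos_planeVec (x n : E3) : pos (planeVec x n) = n := rfl
@[simp] lemma c0_planeVec (x n : E3) : c0 (planeVec x n) = 0 := rfl
@[simp] lemma cInf_planeVec (x n : E3) : cInf (planeVec x n) = 2 * inner ℝ x n := rfl
@[simp] lemma cr_planeVec (x n : E3) : cr (planeVec x n) = 1 := rfl

lemma lieForm_pointVec_pointVec (x y : E3) :
    lieForm (pointVec x) (pointVec y) = -(inner ℝ (x - y) (x - y)) / 2 := by
  simp only [lieForm_apply, pos_pointVec, c0_pointVec, cInf_pointVec, cr_pointVec,
    inner_sub_left, inner_sub_right, real_inner_comm x y]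
  ring

/-- Two spheres in oriented contact at a finite point. -/
structure FiniteContact (s w : LieSpace) : Prop where
  left_null : lieForm s s = 0
  right_null : lieForm w w = 0
  contact : lieForm s w = 0
  finite : c0 (contactVec s w) ≠ 0

lemma contactVec_comm (s w : LieSpace) : contactVec w s = -contactVec s w := by
  simp [contactVec]

lemma contactPoint_comm (s w : LieSpace) : contactPoint w s = contactPoint s w := by
  simp [contactPoint, contactVec_comm s w, inv_neg]

lemma contactNormal_comm (s w : LieSpace) : contactNormal w s = contactNormal s w := by
  rw [contactNormal, contactNormal, contactVec_comm s w, c0_neg, inv_neg, neg_smul, ← smul_neg,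
    ← pos_neg, neg_sub]

namespace FiniteContact

variable {s w : LieSpace}

lemma symm (h : FiniteContact s w) : FiniteContact w s :=
  ⟨h.right_null, h.left_null, by rw [lieForm_comm, h.contact],
    by rw [contactVec_comm, c0_neg]; exact neg_ne_zero.2 h.finite⟩

/-- The `cr`-component cancels by construction, and isotropy then determines the e_∞-component. -/
lemma contactVec_eq (h : FiniteContact s w) :
    contactVec s w = c0 (contactVec s w) • pointVec (contactPoint s w) := by
  have hc := h.finite
  have hpos : pos (contactVec s w) = c0 (contactVec s w) • contactPoint s w := by
    rw [contactPoint, smul_smul, mul_inv_cancel₀ hc, one_smul]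
  have hcr : cr (contactVec s w) = 0 := by simp [contactVec]; ring
  have hnull : lieForm (contactVec s w) (contactVec s w) = 0 := by
    simp [contactVec, h.left_null, h.right_null, h.contact, lieForm_comm w s]
  refine lieSpace_ext ?_ ?_ ?_ ?_
  · simpa using hpos
  · simp
  · rw [lieForm_apply, hcr, hpos, real_inner_smul_left, real_inner_smul_right] at hnull
    rw [cInf_smul, cInf_pointVec]
    apply mul_left_cancel₀ hc
    linear_combination -hnull
  · simpa using hcr

lemma lieForm_contactVec_left (h : FiniteContact s w) : lieForm s (contactVec s w) = 0 := by
  simp [contactVec, h.left_null, h.contact]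

lemma lieForm_pointVec_of_orthogonal (h : FiniteContact s w) {d : LieSpace}
    (hs : lieForm d s = 0) (hw : lieForm d w = 0) :
    lieForm d (pointVec (contactPoint s w)) = 0 := by
  have h1 : lieForm d (contactVec s w) = 0 := by simp [contactVec, hs, hw]
  rw [h.contactVec_eq, map_smul, smul_eq_mul] at h1
  exact (mul_eq_zero.1 h1).resolve_left h.finite

/-- The e_r-component of c0(s) w − c0(w) s equals the e₀-component of `contactVec s w`, so one
factor normalizes both the point and the plane. Orthogonality of point and plane fixes the
e_∞-component. -/
lemma planeVec_eq (h : FiniteContact s w) :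
    c0 (contactVec s w) • planeVec (contactPoint s w) (contactNormal s w) =
      c0 s • w - c0 w • s := by
  have hc := h.finite
  have hpos : pos (c0 s • w - c0 w • s) = c0 (contactVec s w) • contactNormal s w := by
    rw [contactNormal, smul_smul, mul_inv_cancel₀ hc, one_smul]
  have hc0 : c0 (c0 s • w - c0 w • s) = 0 := by simp; ring
  have horth : lieForm (c0 s • w - c0 w • s) (pointVec (contactPoint s w)) = 0 :=
    h.lieForm_pointVec_of_orthogonal
      (by simp [h.left_null, h.contact, lieForm_comm w s])
      (by simp [h.right_null, h.contact])
  refine lieSpace_ext ?_ ?_ ?_ ?_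
  · simpa using hpos.symm
  · rw [hc0]; simp
  · rw [lieForm_apply, hc0, hpos, pos_pointVec, real_inner_smul_left, c0_pointVec, cr_pointVec,
      real_inner_comm] at horth
    rw [cInf_smul, cInf_planeVec]
    linear_combination 2 * horth
  · simp [contactVec]; ring

/-- A sphere which touches a surface element is a combination of its point and its plane. -/
lemma eq_left (h : FiniteContact s w) :
    s = c0 s • pointVec (contactPoint s w)
      + cr s • planeVec (contactPoint s w) (contactNormal s w) := by
  have hc := h.finite
  apply smul_right_injective _ hc
  dsimp only
  rw [smul_add, smul_comm _ (c0 s), smul_comm _ (cr s), ← h.contactVec_eq, h.planeVec_eq,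
    contactVec]
  simp only [c0_sub, c0_smul]
  module

lemma inner_normal_self (h : FiniteContact s w) :
    inner ℝ (contactNormal s w) (contactNormal s w) = 1 := by
  have hc := h.finite
  have h0 : lieForm (c0 s • w - c0 w • s) (c0 s • w - c0 w • s) = 0 := by
    simp [h.left_null, h.right_null, h.contact, lieForm_comm w s]
  rw [← h.planeVec_eq] at h0
  simp only [map_smul, LinearMap.smul_apply, smul_eq_mul, mul_eq_zero, hc, false_or] at h0
  simp only [lieForm_apply, pos_planeVec, c0_planeVec, cInf_planeVec, cr_planeVec] at h0
  linarith

lemma lieForm_planeVec_of_orthogonal (h : FiniteContact s w) {d : LieSpace}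
    (hs : lieForm d s = 0) (hw : lieForm d w = 0) :
    lieForm d (planeVec (contactPoint s w) (contactNormal s w)) = 0 := by
  have h1 : lieForm d (c0 s • w - c0 w • s) = 0 := by simp [hs, hw]
  rw [← h.planeVec_eq, map_smul, smul_eq_mul] at h1
  exact (mul_eq_zero.1 h1).resolve_left h.finite

lemma pos_left (h : FiniteContact s w) :
    pos s = c0 s • contactPoint s w + cr s • contactNormal s w :=
  congrArg pos h.eq_left

end FiniteContact

/-! ### Tangent parts and the reflection in the bisecting plane. -/

/-- The Euclidean vector of `d` modulo the point `x` and the plane with normal `n` through `x`. -/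
noncomputable def tangentPart (d : LieSpace) (x n : E3) : E3 := pos d - c0 d • x - cr d • n

/-- The point and the plane span a totally isotropic space. Its orthogonal complement modulo itself
is a Euclidean plane, realized isometrically as the tangent plane. -/
lemma inner_tangentPart {d d' : LieSpace} {x n : E3} (hn : inner ℝ n n = 1)
    (hx : lieForm d (pointVec x) = 0) (hp : lieForm d (planeVec x n) = 0)
    (hx' : lieForm d' (pointVec x) = 0) (hp' : lieForm d' (planeVec x n) = 0) :
    inner ℝ (tangentPart d x n) (tangentPart d' x n) = lieForm d d' := by
  simp only [lieForm_apply, pos_pointVec, c0_pointVec, cInf_pointVec, cr_pointVec, pos_planeVec,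
    c0_planeVec, cInf_planeVec, cr_planeVec] at *
  simp only [tangentPart, inner_sub_left, inner_sub_right, real_inner_smul_left,
    real_inner_smul_right, real_inner_comm (pos d') x, real_inner_comm (pos d') n,
    real_inner_comm x n, hn] at *
  linear_combination -c0 d' * hx - cr d' * hp - c0 d * hx' - cr d * hp'

lemma inner_tangentPart_normal {d : LieSpace} {x n : E3} (hn : inner ℝ n n = 1)
    (hp : lieForm d (planeVec x n) = 0) :
    inner ℝ (tangentPart d x n) n = 0 := by
  simp only [lieForm_apply, pos_planeVec, c0_planeVec, cInf_planeVec, cr_planeVec] at hp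
  simp only [tangentPart, inner_sub_left, real_inner_smul_left, hn]
  linear_combination hp

/-- The reflection in the perpendicular bisecting plane of `[x, y]`, on vectors. -/
noncomputable def reflectVec (x y w : E3) : E3 :=
  w - (2 * (inner ℝ (y - x) w / inner ℝ (y - x) (y - x))) • (y - x)

lemma reflectVec_smul (x y w : E3) (r : ℝ) : reflectVec x y (r • w) = r • reflectVec x y w := by
  simp only [reflectVec, real_inner_smul_right, mul_div_assoc]
  module

lemma reflectVec_eq {x y w : E3} {r : ℝ} (hxy : x ≠ y)
    (h : 2 * inner ℝ (y - x) w = r * inner ℝ (y - x) (y - x)) :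
    reflectVec x y w = w - r • (y - x) := by
  have hne : inner ℝ (y - x) (y - x) ≠ 0 :=
    (real_inner_self_pos.2 (sub_ne_zero.2 hxy.symm)).ne'
  rw [reflectVec, ← mul_div_assoc, h, mul_div_cancel_right₀ _ hne]

namespace FiniteContact

variable {s s' w : LieSpace}

lemma lieForm_left_pointVec (h : FiniteContact s w) :
    lieForm s (pointVec (contactPoint s w)) = 0 :=
  h.lieForm_pointVec_of_orthogonal h.left_null h.contact

/-- The normals at the points of contact of a sphere with two other spheres. -/
lemma normal_sub_normal (h : FiniteContact s w) (h' : FiniteContact s' w) (hw : cr w ≠ 0) :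
    contactNormal s w - contactNormal s' w =
      (c0 w / cr w) • (contactPoint s' w - contactPoint s w) := by
  have e := h.symm.pos_left
  have e' := h'.symm.pos_left
  rw [contactPoint_comm, contactNormal_comm] at e e'
  apply smul_right_injective _ hw
  dsimp only
  rw [smul_smul, mul_div_cancel₀ _ hw, smul_sub, smul_sub]
  rw [e, ← sub_eq_zero] at e'
  rw [← sub_eq_zero, ← e']
  abel

lemma inner_sub_normal (h : FiniteContact s w) (h' : FiniteContact s' w) (hw : cr w ≠ 0) :
    2 * inner ℝ (contactPoint s' w - contactPoint s w) (contactNormal s w) =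
      c0 w / cr w * inner ℝ (contactPoint s' w - contactPoint s w)
        (contactPoint s' w - contactPoint s w) := by
  have e := h.symm.pos_left
  have e1 := h.symm.lieForm_left_pointVec
  have e2 := h'.symm.lieForm_left_pointVec
  rw [contactPoint_comm, contactNormal_comm] at e
  rw [contactPoint_comm] at e1 e2
  generalize contactPoint s w = x at *
  generalize contactPoint s' w = y at *
  generalize contactNormal s w = n at *
  simp only [lieForm_apply, pos_pointVec, c0_pointVec, cInf_pointVec, cr_pointVec, e,
    inner_add_left, real_inner_smul_left] at e1 e2
  simp only [inner_sub_left, inner_sub_right, real_inner_comm x y, real_inner_comm n y,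
    real_inner_comm n x] at *
  field_simp
  linear_combination 2 * e2 - 2 * e1

lemma reflectVec_normal (h : FiniteContact s w) (h' : FiniteContact s' w) (hw : cr w ≠ 0)
    (hne : contactPoint s w ≠ contactPoint s' w) :
    reflectVec (contactPoint s w) (contactPoint s' w) (contactNormal s w) =
      contactNormal s' w := by
  rw [reflectVec_eq hne (h.inner_sub_normal h' hw), ← h.normal_sub_normal h' hw]
  abel

lemma reflectVec_tangentPart (h : FiniteContact s w) (h' : FiniteContact s' w) (hw : cr w ≠ 0)
    (hne : contactPoint s w ≠ contactPoint s' w) {d : LieSpace}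
    (hs : lieForm d s = 0) (hs' : lieForm d s' = 0) (hdw : lieForm d w = 0) :
    reflectVec (contactPoint s w) (contactPoint s' w)
        (tangentPart d (contactPoint s w) (contactNormal s w)) =
      tangentPart d (contactPoint s' w) (contactNormal s' w) := by
  have e1 := h.lieForm_pointVec_of_orthogonal hs hdw
  have e2 := h'.lieForm_pointVec_of_orthogonal hs' hdw
  have hn := h.inner_sub_normal h' hw
  have hm := h.normal_sub_normal h' hw
  generalize contactPoint s w = x at *
  generalize contactPoint s' w = y at *
  generalize contactNormal s w = n at *
  generalize contactNormal s' w = m at *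
  -- This r is read off from the difference of the two tangent parts, after the normals are
  -- eliminated by `hm`.
  rw [reflectVec_eq (r := c0 d - cr d * (c0 w / cr w)) hne]
  · rw [sub_eq_iff_eq_add] at hm
    rw [tangentPart, tangentPart, hm]
    module
  · simp only [lieForm_apply, pos_pointVec, c0_pointVec, cInf_pointVec, cr_pointVec] at e1 e2
    rw [tangentPart, inner_sub_right, inner_sub_right, real_inner_smul_right,
      real_inner_smul_right]
    simp only [inner_sub_left, inner_sub_right, real_inner_comm x y, real_inner_comm n y,
      real_inner_comm n x, real_inner_comm (pos d)] at *
    linear_combination 2 * e2 - 2 * e1 - cr d * hn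

end FiniteContact

/-! ### Isotropic vectors in signature (++-). -/

namespace IsCyclidicPlane

variable {P : Submodule ℝ LieSpace}

lemma exists_coordinates (hP : IsCyclidicPlane P) :
    ∃ w : Fin 3 → LieSpace,
      (∀ s ∈ P, ∃ x y z : ℝ, s = x • w 0 + y • w 1 + z • w 2) ∧
      ∀ x y z x' y' z' : ℝ, lieForm (x • w 0 + y • w 1 + z • w 2)
        (x' • w 0 + y' • w 1 + z' • w 2) = x * x' + y * y' - z * z' := by
  obtain ⟨w, rfl, hw⟩ := hP
  refine ⟨w, fun s hs => ?_, fun x y z x' y' z' => ?_⟩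
  · obtain ⟨r, rfl⟩ := (Submodule.mem_span_range_iff_exists_fun ℝ).1 hs
    exact ⟨r 0, r 1, r 2, by rw [Fin.sum_univ_three]⟩
  · simp [hw]
    ring

lemma lieForm_ne_zero (hP : IsCyclidicPlane P) {s t : LieSpace} (hs : s ∈ P) (ht : t ∈ P)
    (hs0 : lieForm s s = 0) (ht0 : lieForm t t = 0) (hst : LinearIndependent ℝ ![s, t]) :
    lieForm s t ≠ 0 := by
  intro h
  obtain ⟨w, hw, hform⟩ := hP.exists_coordinates
  obtain ⟨x, y, z, rfl⟩ := hw s hs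
  obtain ⟨x', y', z', rfl⟩ := hw t ht
  rw [hform] at h hs0 ht0
  rw [LinearIndependent.pair_iff] at hst
  -- The combination z' s − z t has no negative coordinate, and it is isotropic if s and t are
  -- orthogonal; hence it vanishes.
  have hsum : (z' * x - z * x') ^ 2 + (z' * y - z * y') ^ 2 = 0 := by
    linear_combination z' ^ 2 * hs0 + z ^ 2 * ht0 - 2 * z * z' * h
  have h1 : z' * x - z * x' = 0 := by nlinarith
  have h2 : z' * y - z * y' = 0 := by nlinarith
  obtain ⟨hz', hz⟩ := hst z' (-z) (by
    have : z' • (x • w 0 + y • w 1 + z • w 2) + -z • (x' • w 0 + y' • w 1 + z' • w 2) =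
        (z' * x - z * x') • w 0 + (z' * y - z * y') • w 1 := by module
    rw [this, h1, h2, zero_smul, zero_smul, add_zero])
  have hz0 : z = 0 := neg_eq_zero.1 hz
  have hx : x = 0 := by rw [hz0] at hs0; nlinarith
  have hy : y = 0 := by rw [hz0] at hs0; nlinarith
  have := (hst 1 0 (by simp [hx, hy, hz0])).1
  exact one_ne_zero this

/-- The left side is the Gram determinant of three isotropic vectors; it equals the determinant of
the form, −1, times the square of the coordinate determinant D. This fixes the sign of the product
of the three mutual products. -/
lemma exists_gram_eq_neg_sq (hP : IsCyclidicPlane P) {s : Fin 3 → LieSpace} (hs : ∀ k, s k ∈ P)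
    (h0 : ∀ k, lieForm (s k) (s k) = 0) :
    ∃ D : ℝ, 2 * (lieForm (s 1) (s 2) * lieForm (s 0) (s 2) * lieForm (s 0) (s 1)) = -D ^ 2 := by
  obtain ⟨w, hw, hform⟩ := hP.exists_coordinates
  obtain ⟨x, y, z, h⟩ := hw _ (hs 0)
  obtain ⟨x', y', z', h'⟩ := hw _ (hs 1)
  obtain ⟨x'', y'', z'', h''⟩ := hw _ (hs 2)
  have e0 := h0 0
  have e1 := h0 1
  have e2 := h0 2
  rw [h, hform] at e0
  rw [h', hform] at e1
  rw [h'', hform] at e2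
  rw [h, h', h'', hform, hform, hform]
  refine ⟨x * (y' * z'' - z' * y'') - y * (x' * z'' - z' * x'') + z * (x' * y'' - y' * x''), ?_⟩
  linear_combination
    ((x' * x'' + y' * y'' - z' * z'') ^ 2 -
      (x' * x' + y' * y' - z' * z') * (x'' * x'' + y'' * y'' - z'' * z'')) * e0 +
    (x * x'' + y * y'' - z * z'') ^ 2 * e1 + (x * x' + y * y' - z * z') ^ 2 * e2

end IsCyclidicPlane

/-! ### Polar forms and derivatives of the quadratic parametrizations. -/

/-- The polar form of the quadratic parametrization `familyParam`. -/
noncomputable def blossom (s : Fin 3 → LieSpace) (p q : ℝ) : LieSpace :=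
  (lieForm (s 1) (s 2) * (2 * (p * q) - 3 * ((p + q) / 2) + 1)) • s 0
    + (lieForm (s 0) (s 2) * ((p + q) / 2 - p * q)) • s 1
    + (lieForm (s 0) (s 1) * (2 * (p * q) - (p + q) / 2)) • s 2

lemma blossom_comm (s : Fin 3 → LieSpace) (p q : ℝ) : blossom s q p = blossom s p q := by
  simp only [blossom, mul_comm q p, add_comm q p]

lemma blossom_self (s : Fin 3 → LieSpace) (p : ℝ) : blossom s p p = familyParam s p := by
  rw [blossom, familyParam]
  congr 4 <;> ring

lemma blossom_mem {P : Submodule ℝ LieSpace} {s : Fin 3 → LieSpace} (hs : ∀ k, s k ∈ P)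
    (p q : ℝ) : blossom s p q ∈ P :=
  P.add_mem (P.add_mem (P.smul_mem _ (hs 0)) (P.smul_mem _ (hs 1))) (P.smul_mem _ (hs 2))

/-- Polarization of ⟨s(p), s(p')⟩ = K (p − p')², with K the product of the three mutual products of
the reference spheres. As K is negative, the polar form at distinct parameters has positive square.
-/
lemma lieForm_blossom_blossom {s : Fin 3 → LieSpace} (h0 : ∀ k, lieForm (s k) (s k) = 0)
    (p q p' q' : ℝ) :
    lieForm (blossom s p q) (blossom s p' q') =
      lieForm (s 1) (s 2) * lieForm (s 0) (s 2) * lieForm (s 0) (s 1) *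
        ((p - p') * (q - q') + (p - q') * (q - p')) / 2 := by
  simp only [blossom, map_add, map_smul, LinearMap.add_apply, LinearMap.smul_apply, smul_eq_mul,
    h0, lieForm_comm (s 1) (s 0), lieForm_comm (s 2) (s 0), lieForm_comm (s 2) (s 1)]
  ring

/-- The polar form is affine in q and agrees with the curve at q = p, so its secant over any q gives
half the derivative. Taking q as the other end of the interval later brings in the same polar form
at both ends. -/
lemma hasDerivAt_familyParam (s : Fin 3 → LieSpace) {p q : ℝ} (hpq : p ≠ q) :
    HasDerivAt (familyParam s) ((2 / (q - p)) • (blossom s p q - familyParam s p)) p := by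
  have hsq : HasDerivAt (fun t : ℝ => t ^ 2) (2 * p) p := by simpa using hasDerivAt_pow 2 p
  have hid := hasDerivAt_id' p
  have h0 := (((((hsq.const_mul 2).sub (hid.const_mul 3)).add_const 1).const_mul
    (lieForm (s 1) (s 2))).smul_const (s 0))
  have h1 := ((hid.sub hsq).const_mul (lieForm (s 0) (s 2))).smul_const (s 1)
  have h2 := (((hsq.const_mul 2).sub hid).const_mul (lieForm (s 0) (s 1))).smul_const (s 2)
  refine ((h0.add h1).add h2).congr_deriv ?_
  have hne : q - p ≠ 0 := sub_ne_zero.2 hpq.symm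
  rw [blossom, familyParam, eq_comm]
  match_scalars <;> field_simp <;> ring

/-- Moving in the direction of s only rescales the contact vector, so only b contributes, and only
modulo the contact element. -/
lemma hasDerivAt_contactPoint {s w : LieSpace} {γ : ℝ → LieSpace} {p κ : ℝ} {b : LieSpace}
    (hγ : HasDerivAt γ (κ • (b - s)) p) (hs : γ p = s) (h : FiniteContact s w) :
    HasDerivAt (fun t => contactPoint (γ t) w)
      ((κ * (cr w / c0 (contactVec s w))) •
        tangentPart b (contactPoint s w) (contactNormal s w)) p := by
  subst hs
  have hpos : HasDerivAt (fun t => pos (γ t)) (pos (κ • (b - γ p))) p := hγ.fst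
  have hc0 : HasDerivAt (fun t => c0 (γ t)) (c0 (κ • (b - γ p))) p := hγ.snd.fst
  have hcr : HasDerivAt (fun t => cr (γ t)) (cr (κ • (b - γ p))) p := hγ.snd.snd.snd
  have hV0 : HasDerivAt (fun t => c0 (contactVec (γ t) w))
      (cr w * c0 (κ • (b - γ p)) - cr (κ • (b - γ p)) * c0 w) p :=
    (hc0.const_mul _).sub (hcr.mul_const _)
  have hVpos : HasDerivAt (fun t => pos (contactVec (γ t) w))
      (cr w • pos (κ • (b - γ p)) - cr (κ • (b - γ p)) • pos w) p :=
    (hpos.const_smul (cr w)).sub (hcr.smul_const (pos w))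
  refine ((hV0.inv h.finite).smul hVpos).congr_deriv ?_
  have hc := h.finite
  have hw := h.symm.pos_left
  rw [contactPoint_comm, contactNormal_comm] at hw
  have hV : pos (contactVec (γ p) w) = c0 (contactVec (γ p) w) • contactPoint (γ p) w :=
    congrArg pos h.contactVec_eq
  rw [hV]
  simp only [pos_smul, pos_sub, c0_smul, c0_sub, cr_smul, cr_sub, hw, h.pos_left, tangentPart,
    Pi.inv_apply]
  generalize c0 (contactVec (γ p) w) = c at *
  match_scalars <;> field_simp <;> ring

/-! ### Signs, written as r * |r|⁻¹. -/

lemma unit_smul (r : ℝ) (w : E3) : Patch.unit (r • w) = (r * |r|⁻¹) • Patch.unit w := by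
  rw [Patch.unit, Patch.unit, norm_smul, mul_inv, Real.norm_eq_abs]
  module

lemma unit_eq_of_inner_self {w : E3} {r : ℝ} (h : inner ℝ w w = r) :
    Patch.unit w = (√r)⁻¹ • w := by
  rw [Patch.unit, ← h, real_inner_self_eq_norm_sq, Real.sqrt_sq (norm_nonneg _)]

lemma mul_inv_abs_of_pos {r : ℝ} (h : 0 < r) : r * |r|⁻¹ = 1 := by
  rw [abs_of_pos h, mul_inv_cancel₀ h.ne']

lemma mul_inv_abs_mul (r t : ℝ) : r * t * |r * t|⁻¹ = (r * |r|⁻¹) * (t * |t|⁻¹) := by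
  rw [abs_mul, mul_inv]
  ring

lemma mul_inv_abs_sq {r : ℝ} (h : r ≠ 0) : (r * |r|⁻¹) * (r * |r|⁻¹) = 1 := by
  rw [← mul_inv_abs_mul, mul_inv_abs_of_pos (mul_self_pos.2 h)]

/-! ### The grid of four contact elements. -/

/-- Two spheres of each of the two families of a cyclide, given by values `s i` and `w j` of
quadratic parametrizations, together with the values `b` and `d` of the polar forms of these
parametrizations. -/
structure ContactGrid where
  s : Bool → LieSpace
  w : Bool → LieSpace
  b : LieSpace
  d : LieSpace
  contact : ∀ i j, FiniteContact (s i) (w j)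
  b_s : ∀ i, lieForm b (s i) = 0
  b_w : ∀ j, lieForm b (w j) = 0
  d_s : ∀ i, lieForm d (s i) = 0
  d_w : ∀ j, lieForm d (w j) = 0
  b_d : lieForm b d = 0
  b_pos : 0 < lieForm b b
  d_pos : 0 < lieForm d d
  s_s : ∀ i, lieForm (s i) (s (!i)) = -2 * lieForm b b
  w_w : ∀ j, lieForm (w j) (w (!j)) = -2 * lieForm d d

namespace ContactGrid

variable (G : ContactGrid)

/-- Interchange of the two families. -/
def swap : ContactGrid where
  s := G.w
  w := G.s
  b := G.d
  d := G.b
  contact i j := (G.contact j i).symm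
  b_s := G.d_w
  b_w := G.d_s
  d_s := G.b_w
  d_w := G.b_s
  b_d := by rw [lieForm_comm, G.b_d]
  b_pos := G.d_pos
  d_pos := G.b_pos
  s_s := G.w_w
  w_w := G.s_s

/-- The points of contact. -/
noncomputable def x (i j : Bool) : E3 := contactPoint (G.s i) (G.w j)

/-- The unit normals. -/
noncomputable def n (i j : Bool) : E3 := contactNormal (G.s i) (G.w j)

/-- The scaling factors of the points of contact. -/
noncomputable def c (i j : Bool) : ℝ := c0 (contactVec (G.s i) (G.w j))

/-- The unit tangents in the first direction. -/
noncomputable def tangent (i j : Bool) : E3 :=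
  (cr (G.w j) / G.c i j * |cr (G.w j) / G.c i j|⁻¹) •
    Patch.unit (tangentPart G.b (G.x i j) (G.n i j))

/-- No sphere is a point. -/
def Nonsingular : Prop := (∀ i, cr (G.s i) ≠ 0) ∧ ∀ j, cr (G.w j) ≠ 0

variable {G}

lemma Nonsingular.swap (h : G.Nonsingular) : G.swap.Nonsingular := And.symm h

lemma x_swap (i j : Bool) : G.swap.x j i = G.x i j := contactPoint_comm _ _

lemma n_swap (i j : Bool) : G.swap.n j i = G.n i j := contactNormal_comm _ _

lemma c_swap (i j : Bool) : G.swap.c j i = -G.c i j := by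
  rw [c, c, ← c0_neg, ← contactVec_comm]
  rfl

lemma c_ne_zero (i j : Bool) : G.c i j ≠ 0 := (G.contact i j).finite

lemma contactVec_eq (i j : Bool) :
    contactVec (G.s i) (G.w j) = G.c i j • pointVec (G.x i j) := (G.contact i j).contactVec_eq

lemma inner_normal_self (i j : Bool) : inner ℝ (G.n i j) (G.n i j) = 1 :=
  (G.contact i j).inner_normal_self

lemma lieForm_b_pointVec (i j : Bool) : lieForm G.b (pointVec (G.x i j)) = 0 :=
  (G.contact i j).lieForm_pointVec_of_orthogonal (G.b_s i) (G.b_w j)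

lemma lieForm_b_planeVec (i j : Bool) : lieForm G.b (planeVec (G.x i j) (G.n i j)) = 0 :=
  (G.contact i j).lieForm_planeVec_of_orthogonal (G.b_s i) (G.b_w j)

lemma inner_tangentPart_self (i j : Bool) :
    inner ℝ (tangentPart G.b (G.x i j) (G.n i j)) (tangentPart G.b (G.x i j) (G.n i j)) =
      lieForm G.b G.b :=
  inner_tangentPart (inner_normal_self i j) (lieForm_b_pointVec i j) (lieForm_b_planeVec i j)
    (lieForm_b_pointVec i j) (lieForm_b_planeVec i j)

lemma unit_tangentPart (i j : Bool) :
    Patch.unit (tangentPart G.b (G.x i j) (G.n i j)) =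
      (√(lieForm G.b G.b))⁻¹ • tangentPart G.b (G.x i j) (G.n i j) :=
  unit_eq_of_inner_self (inner_tangentPart_self i j)

lemma inner_tangent_self (h : G.Nonsingular) (i j : Bool) :
    inner ℝ (G.tangent i j) (G.tangent i j) = 1 := by
  rw [tangent, unit_tangentPart, real_inner_smul_left, real_inner_smul_right, ← mul_assoc,
    mul_inv_abs_sq (div_ne_zero (h.2 j) (c_ne_zero i j)), real_inner_smul_left,
    real_inner_smul_right, inner_tangentPart_self, one_mul, ← mul_assoc, ← mul_inv,
    Real.mul_self_sqrt G.b_pos.le, inv_mul_cancel₀ G.b_pos.ne']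

lemma inner_tangent_normal (i j : Bool) : inner ℝ (G.tangent i j) (G.n i j) = 0 := by
  rw [tangent, unit_tangentPart, real_inner_smul_left, real_inner_smul_left,
    inner_tangentPart_normal (inner_normal_self i j) (lieForm_b_planeVec i j), mul_zero, mul_zero]

lemma inner_tangent_tangent (i j : Bool) :
    inner ℝ (G.tangent i j) (G.swap.tangent j i) = 0 := by
  have h1 := G.swap.lieForm_b_pointVec j i
  have h2 := G.swap.lieForm_b_planeVec j i
  rw [tangent, unit_tangentPart, real_inner_smul_left, real_inner_smul_left,
    tangent, unit_tangentPart, real_inner_smul_right, real_inner_smul_right, x_swap, n_swap]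
  rw [x_swap] at h1
  rw [x_swap, n_swap] at h2
  rw [inner_tangentPart (inner_normal_self i j) (lieForm_b_pointVec i j)
    (lieForm_b_planeVec i j) h1 h2, show lieForm G.b G.swap.b = 0 from G.b_d]
  simp

/-- If the points agreed, the sphere s_i' would be orthogonal to the contact vector at (i, j), but
that product is cr(w_j) ⟨s_i', s_i⟩ ≠ 0. -/
lemma x_ne_of_left_ne (h : G.Nonsingular) (i j j' : Bool) : G.x i j ≠ G.x (!i) j' := by
  intro hx
  have h1 : lieForm (G.s (!i)) (contactVec (G.s (!i)) (G.w j')) = 0 :=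
    (G.contact _ _).lieForm_contactVec_left
  rw [contactVec_eq, ← hx, map_smul, smul_eq_mul] at h1
  have h2 := (mul_eq_zero.1 h1).resolve_left (c_ne_zero _ _)
  have h3 : lieForm (G.s (!i)) (contactVec (G.s i) (G.w j)) = 0 := by
    rw [contactVec_eq, map_smul, h2, smul_zero]
  rw [contactVec, map_sub, map_smul, map_smul, (G.contact _ _).contact, smul_zero, sub_zero,
    lieForm_comm, G.s_s, smul_eq_mul] at h3
  exact mul_ne_zero (h.2 j) (mul_ne_zero (by norm_num) G.b_pos.ne') h3

lemma x_ne_of_right_ne (h : G.Nonsingular) (i i' j : Bool) : G.x i j ≠ G.x i' (!j) := by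
  rw [← x_swap i, ← x_swap i']
  exact x_ne_of_left_ne h.swap j i i'

/-- The product of the two contact vectors is −2 cr(w_j)² ⟨b, b⟩ < 0, and also −c c' |x − x'|²/2 by
the distance formula for lifts. -/
lemma c_mul_c_pos (h : G.Nonsingular) (i j : Bool) : 0 < G.c i j * G.c (!i) j := by
  have h1 : lieForm (contactVec (G.s i) (G.w j)) (contactVec (G.s (!i)) (G.w j)) =
      -2 * cr (G.w j) ^ 2 * lieForm G.b G.b := by
    simp only [contactVec, map_sub, map_smul, LinearMap.sub_apply, LinearMap.smul_apply,
      smul_eq_mul, (G.contact _ _).contact, (G.contact i j).right_null, G.s_s,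
      lieForm_comm (G.w j)]
    ring
  rw [contactVec_eq, contactVec_eq] at h1
  simp only [map_smul, LinearMap.smul_apply, smul_eq_mul, lieForm_pointVec_pointVec] at h1
  have hw : 0 < cr (G.w j) ^ 2 := by have := h.2 j; positivity
  have hD : 0 < inner ℝ (G.x i j - G.x (!i) j) (G.x i j - G.x (!i) j) :=
    real_inner_self_pos.2 (sub_ne_zero.2 (x_ne_of_left_ne h i j j))
  refine (mul_pos_iff_of_pos_right hD).1 ?_
  have := mul_pos hw G.b_pos
  linear_combination 4 * this + 2 * h1

lemma c_mul_c_pos' (h : G.Nonsingular) (i j : Bool) : 0 < G.c i j * G.c i (!j) := by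
  simpa [c_swap] using c_mul_c_pos h.swap j i

lemma reflectVec_normal (h : G.Nonsingular) (i j : Bool) :
    reflectVec (G.x i j) (G.x (!i) j) (G.n i j) = G.n (!i) j :=
  (G.contact i j).reflectVec_normal (G.contact (!i) j) (h.2 j) (x_ne_of_left_ne h i j j)

lemma reflectVec_unit_tangentPart (h : G.Nonsingular) (i j : Bool) :
    reflectVec (G.x i j) (G.x (!i) j) (Patch.unit (tangentPart G.b (G.x i j) (G.n i j))) =
      Patch.unit (tangentPart G.b (G.x (!i) j) (G.n (!i) j)) := by
  rw [unit_tangentPart, unit_tangentPart, reflectVec_smul]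
  congr 1
  exact (G.contact i j).reflectVec_tangentPart (G.contact (!i) j) (h.2 j)
    (x_ne_of_left_ne h i j j) (G.b_s _) (G.b_s _) (G.b_w _)

lemma reflectVec_unit_tangentPart_swap (h : G.Nonsingular) (i j : Bool) :
    reflectVec (G.x i j) (G.x (!i) j) (Patch.unit (tangentPart G.d (G.x i j) (G.n i j))) =
      Patch.unit (tangentPart G.d (G.x (!i) j) (G.n (!i) j)) := by
  have e1 := G.swap.unit_tangentPart j i
  have e2 := G.swap.unit_tangentPart j (!i)
  rw [x_swap, n_swap] at e1 e2
  change Patch.unit (tangentPart G.d _ _) = _ • tangentPart G.d _ _ at e1 e2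
  rw [e1, e2, reflectVec_smul]
  congr 1
  exact (G.contact i j).reflectVec_tangentPart (G.contact (!i) j) (h.2 j)
    (x_ne_of_left_ne h i j j) (G.d_s _) (G.d_s _) (G.d_w _)

lemma reflectVec_tangent (h : G.Nonsingular) (i j : Bool) :
    reflectVec (G.x i j) (G.x (!i) j) (G.tangent i j) = G.tangent (!i) j := by
  rw [tangent, tangent, reflectVec_smul, reflectVec_unit_tangentPart h]
  congr 1
  have hc := c_mul_c_pos h i j
  have hw : 0 < cr (G.w j) ^ 2 := by have := h.2 j; positivity
  set r := cr (G.w j) / G.c i j with hr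
  set t := cr (G.w j) / G.c (!i) j with ht
  have hpos : 0 < r * t := by
    have : r * t = cr (G.w j) ^ 2 / (G.c i j * G.c (!i) j) := by rw [hr, ht]; ring
    rw [this]
    exact div_pos hw hc
  have hr0 : r ≠ 0 := left_ne_zero_of_mul hpos.ne'
  have h1 := mul_inv_abs_mul r t
  rw [mul_inv_abs_of_pos hpos] at h1
  linear_combination (r * |r|⁻¹) * h1 + (t * |t|⁻¹) * mul_inv_abs_sq hr0

/-- The tangents in the second direction are reflected up to the sign of the product of the radii. -/
lemma reflectVec_tangent_swap (h : G.Nonsingular) (i j : Bool) :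
    reflectVec (G.x i j) (G.x (!i) j) (G.swap.tangent j i) =
      (cr (G.s i) * cr (G.s (!i)) * |cr (G.s i) * cr (G.s (!i))|⁻¹) • G.swap.tangent j (!i) := by
  rw [tangent, tangent, reflectVec_smul, x_swap, x_swap, n_swap, n_swap, smul_smul, c_swap, c_swap]
  change _ • reflectVec _ _ (Patch.unit (tangentPart G.d _ _)) =
    _ • (Patch.unit (tangentPart G.d _ _))
  rw [reflectVec_unit_tangentPart_swap h]
  congr 1
  change cr (G.s i) / -G.c i j * |cr (G.s i) / -G.c i j|⁻¹ = _ *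
    (cr (G.s (!i)) / -G.c (!i) j * |cr (G.s (!i)) / -G.c (!i) j|⁻¹)
  have hc := c_mul_c_pos h i j
  have hi := h.1 i
  have hi' := h.1 (!i)
  have hci := c_ne_zero (G := G) i j
  have hci' := c_ne_zero (G := G) (!i) j
  rw [← mul_inv_abs_mul]
  -- The two sides differ by a positive factor because c_ij and c_i'j have the same sign; only the
  -- sign of the product of the `cr`-values survives.
  have e : cr (G.s i) * cr (G.s (!i)) * (cr (G.s (!i)) / -G.c (!i) j) =
      (cr (G.s (!i)) ^ 2 * (G.c i j ^ 2 / (G.c i j * G.c (!i) j))) * (cr (G.s i) / -G.c i j) := by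
    field_simp
  have hpos : 0 < cr (G.s (!i)) ^ 2 * (G.c i j ^ 2 / (G.c i j * G.c (!i) j)) :=
    mul_pos (by positivity) (div_pos (by positivity) hc)
  rw [e, mul_inv_abs_mul (cr (G.s (!i)) ^ 2 * _), mul_inv_abs_of_pos hpos, one_mul]

lemma liftRelation (i j : Bool) :
    LiftRelation (G.x i j) (G.x (!i) j) (G.x i (!j)) (G.x (!i) (!j))
      (cr (G.s (!i)) * cr (G.w (!j)) * G.c i j) (-(cr (G.s i) * cr (G.w (!j)) * G.c (!i) j))
      (-(cr (G.s (!i)) * cr (G.w j) * G.c i (!j))) (cr (G.s i) * cr (G.w j) * G.c (!i) (!j)) := by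
  have key : (cr (G.s (!i)) * cr (G.w (!j)) * G.c i j) • pointVec (G.x i j)
      + (-(cr (G.s i) * cr (G.w (!j)) * G.c (!i) j)) • pointVec (G.x (!i) j)
      + (-(cr (G.s (!i)) * cr (G.w j) * G.c i (!j))) • pointVec (G.x i (!j))
      + (cr (G.s i) * cr (G.w j) * G.c (!i) (!j)) • pointVec (G.x (!i) (!j)) = 0 := by
    simp only [neg_smul, mul_smul _ (G.c _ _), ← contactVec_eq, contactVec]
    module
  refine ⟨?_, ?_, ?_⟩
  · simpa using congrArg c0 key
  · simpa using congrArg pos key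
  · simpa using congrArg cInf key

lemma separated_iff (h : G.Nonsingular) (i j : Bool) :
    Separated (G.x i j) (G.x (!i) j) (G.x i (!j)) (G.x (!i) (!j)) ↔
      cr (G.s i) * cr (G.s (!i)) < 0 := by
  have hc := c_mul_c_pos h i j
  have hi := h.1 i
  have hi' := h.1 (!i)
  have hj := h.2 j
  have hj' := h.2 (!j)
  have l := x_ne_of_left_ne h
  have r := x_ne_of_right_ne h
  rw [(G.liftRelation i j).separated_iff
    (neg_ne_zero.2 (mul_ne_zero (mul_ne_zero hi hj') (c_ne_zero _ _)))
    (neg_ne_zero.2 (mul_ne_zero (mul_ne_zero hi' hj) (c_ne_zero _ _)))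
    (mul_ne_zero (mul_ne_zero hi hj) (c_ne_zero _ _))
    (l i j j) (r i i j) (l i j (!j)) (r (!i) i j) (r (!i) (!i) j) (l i (!j) (!j))]
  have e : cr (G.s (!i)) * cr (G.w (!j)) * G.c i j * -(cr (G.s i) * cr (G.w (!j)) * G.c (!i) j) =
      -(cr (G.s i) * cr (G.s (!i))) * (cr (G.w (!j)) ^ 2 * (G.c i j * G.c (!i) j)) := by ring
  rw [e, mul_pos_iff_of_pos_right (by positivity), neg_pos]

/-- The end points of at most one pair of opposite sides are mutually separated. -/
lemma not_both_neg (h : G.Nonsingular) :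
    ¬ (cr (G.s false) * cr (G.s true) < 0 ∧ cr (G.w false) * cr (G.w true) < 0) := by
  rintro ⟨hs, hw⟩
  have hsum := (G.liftRelation false false).sum_weights
  simp only [Bool.not_false] at hsum
  have h1 := c_mul_c_pos h false false
  have h2 := c_mul_c_pos' h false false
  have h3 := c_mul_c_pos h false true
  simp only [Bool.not_false] at h1 h2 h3
  -- If both products were negative, every other weight would have the sign of p, and the weights
  -- could not sum to zero.
  set p := cr (G.s true) * cr (G.w true) * G.c false false with hp
  have hp0 : p ≠ 0 := mul_ne_zero (mul_ne_zero (h.1 _) (h.2 _)) (c_ne_zero _ _)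
  have e1 : 0 < p * -(cr (G.s false) * cr (G.w true) * G.c true false) := by
    have := mul_pos (mul_pos (neg_pos.2 hs) h1) (pow_pos (abs_pos.2 (h.2 true)) 2)
    rw [sq_abs] at this
    rw [hp]
    linear_combination this
  have e2 : 0 < p * -(cr (G.s true) * cr (G.w false) * G.c false true) := by
    have := mul_pos (mul_pos (neg_pos.2 hw) h2) (pow_pos (abs_pos.2 (h.1 true)) 2)
    rw [sq_abs] at this
    rw [hp]
    linear_combination this
  have e3 : 0 < p * (cr (G.s false) * cr (G.w false) * G.c true true) := by
    have h4 : 0 < G.c false false * G.c true true := by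
      have := pow_pos (abs_pos.2 (c_ne_zero (G := G) false true)) 2
      rw [sq_abs] at this
      refine (mul_pos_iff_of_pos_right this).1 ?_
      linear_combination mul_pos h2 h3
    rw [hp]
    linear_combination mul_pos (mul_pos_of_neg_of_neg hs hw) h4
  have e0 : 0 < p * p := mul_self_pos.2 hp0
  have := congrArg (p * ·) hsum
  simp only [mul_add, mul_zero] at this
  linarith

/-- A point sphere is itself the point of contact, whatever j is. Finiteness rules out that w_j is a
point sphere too. -/
lemma x_eq_of_cr_eq_zero {i : Bool} (h : cr (G.s i) = 0) (j : Bool) :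
    G.x i j = (c0 (G.s i))⁻¹ • pos (G.s i) := by
  have hw : cr (G.w j) ≠ 0 := by
    intro hw
    apply c_ne_zero (G := G) i j
    simp [c, contactVec, h, hw]
  simp only [x, contactPoint, contactVec, h, zero_smul, sub_zero, c0_smul, pos_smul, smul_smul]
  congr 1
  field_simp

lemma x_eq_x_of_cr_eq_zero {i : Bool} (h : cr (G.s i) = 0) : G.x i true = G.x i false := by
  rw [x_eq_of_cr_eq_zero h, x_eq_of_cr_eq_zero h]

lemma x_eq_x_of_cr_eq_zero' {j : Bool} (h : cr (G.w j) = 0) : G.x true j = G.x false j := by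
  rw [← x_swap true j, ← x_swap false j]
  exact x_eq_x_of_cr_eq_zero h

lemma concircular :
    Concircular {G.x false false, G.x true false, G.x true true, G.x false true} := by
  by_cases hs : ∀ i, cr (G.s i) ≠ 0
  · by_cases hw : ∀ j, cr (G.w j) ≠ 0
    · have h := (G.liftRelation false false).concircular
        (mul_ne_zero (mul_ne_zero (hs _) (hw _)) (c_ne_zero _ _))
      simp only [Bool.not_false] at h
      convert h using 1
      grind
    · push Not at hw
      obtain ⟨j, hj⟩ := hw
      have e := x_eq_x_of_cr_eq_zero' hj
      cases j
      · convert concircular_triple (G.x false false) (G.x true true) (G.x false true) using 1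
        grind
      · convert concircular_triple (G.x false false) (G.x true false) (G.x true true) using 1
        grind
  · push Not at hs
    obtain ⟨i, hi⟩ := hs
    have e := x_eq_x_of_cr_eq_zero hi
    cases i
    · convert concircular_triple (G.x false false) (G.x true false) (G.x true true) using 1
      grind
    · convert concircular_triple (G.x false false) (G.x true true) (G.x false true) using 1
      grind

end ContactGrid

/-! ### Reversals, reflected frames and intersecting lines. -/

lemma separated_comm (a b c d : E3) : Separated a b c d ↔ Separated a b d c := by
  rw [Separated, Separated, xor_comm, AffineSubspace.sOppSide_comm,
    show ({a, b, c, d} : Set E3) = {a, b, d, c} by grind]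

lemma reflectFrame_eq (x y a b c : E3) :
    reflectFrame x y ![a, b, c] = ![reflectVec x y a, reflectVec x y b, reflectVec x y c] := by
  funext k
  fin_cases k <;> rfl

lemma reflectFrame_flip₁ (x y : E3) (B : Fin 3 → E3) :
    reflectFrame x y (flip₁ B) = flip₁ (reflectFrame x y B) := by
  have h := reflectVec_smul x y (B 0) (-1)
  simp only [neg_smul, one_smul] at h
  rw [flip₁, reflectFrame_eq, h]
  rfl

lemma reflectFrame_flip₂ (x y : E3) (B : Fin 3 → E3) :
    reflectFrame x y (flip₂ B) = flip₂ (reflectFrame x y B) := by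
  have h := reflectVec_smul x y (B 1) (-1)
  simp only [neg_smul, one_smul] at h
  rw [flip₂, reflectFrame_eq, h]
  rfl

/-- A second common point y would give both lines the direction y − z, making them equal. -/
lemma inter_lines_eq_singleton {p q n m z : E3}
    (hp : z ∈ AffineSubspace.mk' p (Submodule.span ℝ {n}))
    (hq : z ∈ AffineSubspace.mk' q (Submodule.span ℝ {m}))
    (hne : AffineSubspace.mk' p (Submodule.span ℝ {n}) ≠
      AffineSubspace.mk' q (Submodule.span ℝ {m})) :
    (AffineSubspace.mk' p (Submodule.span ℝ {n}) : Set E3) ∩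
      AffineSubspace.mk' q (Submodule.span ℝ {m}) = {z} := by
  refine Set.Subset.antisymm ?_ (Set.singleton_subset_iff.2 ⟨hp, hq⟩)
  rintro y ⟨hy, hy'⟩
  by_contra hyz
  have hv : y - z ≠ 0 := sub_ne_zero.2 hyz
  have span_eq {p n : E3} (h : z ∈ AffineSubspace.mk' p (Submodule.span ℝ {n}))
      (h' : y ∈ AffineSubspace.mk' p (Submodule.span ℝ {n})) :
      Submodule.span ℝ {y - z} = Submodule.span ℝ {n} := by
    have hmem := AffineSubspace.vsub_mem_direction h' h
    rw [AffineSubspace.direction_mk'] at hmem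
    obtain ⟨r, hr⟩ := Submodule.mem_span_singleton.1 hmem
    rw [vsub_eq_sub] at hr
    have hr0 : r ≠ 0 := by
      rintro rfl
      exact hv (by rw [← hr, zero_smul])
    rw [← hr]
    exact Submodule.span_singleton_smul_eq (IsUnit.mk0 r hr0) n
  apply hne
  refine AffineSubspace.ext_of_direction_eq ?_ ⟨z, hp, hq⟩
  rw [AffineSubspace.direction_mk', AffineSubspace.direction_mk', ← span_eq hp hy,
    ← span_eq hq hy']

/-! ### Frames and normal lines of a grid. -/

namespace ContactGrid

variable {G : ContactGrid}

variable (G) in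
/-- The frame at a point of contact. -/
noncomputable def frame (i j : Bool) : Fin 3 → E3 :=
  ![G.tangent i j, G.swap.tangent j i, G.n i j]

lemma orthonormal_frame (h : G.Nonsingular) (i j : Bool) : Orthonormal ℝ (G.frame i j) := by
  have h1 := inner_tangent_self h i j
  have h2 := inner_tangent_self h.swap j i
  have h3 := G.inner_normal_self i j
  have h12 := G.inner_tangent_tangent i j
  have h13 := G.inner_tangent_normal i j
  have h23 := G.swap.inner_tangent_normal j i
  rw [n_swap] at h23
  have h21 := h12
  have h31 := h13
  have h32 := h23
  rw [real_inner_comm] at h21 h31 h32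
  rw [orthonormal_iff_ite]
  intro k l
  fin_cases k <;> fin_cases l
  exacts [h1, h12, h13, h21, h2, h23, h31, h32, h3]

lemma injective_x (h : G.Nonsingular) :
    Function.Injective fun p : Bool × Bool => G.x p.1 p.2 := by
  rintro ⟨i, j⟩ ⟨i', j'⟩ hx
  dsimp only at hx
  by_cases hi : i' = i
  · by_cases hj : j' = j
    · rw [hi, hj]
    · rw [Bool.eq_not_of_ne hj] at hx
      exact absurd hx (x_ne_of_right_ne h _ _ _)
  · rw [Bool.eq_not_of_ne hi] at hx
    exact absurd hx (x_ne_of_left_ne h _ _ _)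

lemma frame_left_of_pos (h : G.Nonsingular) {i : Bool} (j : Bool)
    (hs : 0 < cr (G.s i) * cr (G.s (!i))) :
    G.frame (!i) j = reflectFrame (G.x i j) (G.x (!i) j) (G.frame i j) := by
  rw [frame, frame, reflectFrame_eq, reflectVec_tangent h, reflectVec_normal h,
    reflectVec_tangent_swap h, mul_inv_abs_of_pos hs, one_smul]

lemma frame_left_of_neg (h : G.Nonsingular) {i : Bool} (j : Bool)
    (hs : cr (G.s i) * cr (G.s (!i)) < 0) :
    G.frame (!i) j = flip₂ (reflectFrame (G.x i j) (G.x (!i) j) (G.frame i j)) := by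
  rw [frame, frame, reflectFrame_eq, reflectVec_tangent h, reflectVec_normal h,
    reflectVec_tangent_swap h, abs_of_neg hs, inv_neg, mul_neg, mul_inv_cancel₀ hs.ne, flip₂]
  simp

/-- Interchanging the families exchanges the two tangents, so every statement in direction 2 follows
from direction 1, with `flip₂` turning into `flip₁`. -/
lemma frame_eq_swap (i j : Bool) :
    G.frame i j = G.swap.frame j i ∘ ![1, 0, 2] := by
  funext k
  fin_cases k
  · rfl
  · rfl
  · exact (n_swap i j).symm

lemma frame_right_of_pos (h : G.Nonsingular) (i : Bool) {j : Bool}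
    (hw : 0 < cr (G.w j) * cr (G.w (!j))) :
    G.frame i (!j) = reflectFrame (G.x i j) (G.x i (!j)) (G.frame i j) := by
  rw [frame_eq_swap, frame_left_of_pos h.swap i hw, x_swap, x_swap, frame_eq_swap i j]
  rfl

lemma frame_right_of_neg (h : G.Nonsingular) (i : Bool) {j : Bool}
    (hw : cr (G.w j) * cr (G.w (!j)) < 0) :
    G.frame i (!j) = flip₁ (reflectFrame (G.x i j) (G.x i (!j)) (G.frame i j)) := by
  rw [frame_eq_swap, frame_left_of_neg h.swap i hw, x_swap, x_swap, frame_eq_swap i j]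
  funext k
  fin_cases k <;> rfl

lemma separated_swap_iff (h : G.Nonsingular) (i j : Bool) :
    Separated (G.x i j) (G.x i (!j)) (G.x (!i) j) (G.x (!i) (!j)) ↔
      cr (G.w j) * cr (G.w (!j)) < 0 := by
  have := separated_iff h.swap j i
  simp only [x_swap] at this
  exact this

variable (G) in
/-- The normal line at a point of contact. -/
noncomputable def normalLine (i j : Bool) : AffineSubspace ℝ E3 :=
  AffineSubspace.mk' (G.x i j) (Submodule.span ℝ {G.n i j})

lemma center_mem_normalLine {j : Bool} (hw : c0 (G.w j) ≠ 0) (i : Bool) :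
    center (G.w j) ∈ G.normalLine i j := by
  rw [normalLine, AffineSubspace.mem_mk', vsub_eq_sub, Submodule.mem_span_singleton]
  have e := (G.contact i j).symm.pos_left
  rw [contactPoint_comm, contactNormal_comm] at e
  -- From pos w = c0(w) x + cr(w) n the centre is x + (cr w / c0 w) n.
  refine ⟨cr (G.w j) / c0 (G.w j), ?_⟩
  rw [center, e, x, n]
  match_scalars <;> field_simp
  ring

lemma normalLine_inter {j : Bool} (hw : c0 (G.w j) ≠ 0) (i : Bool)
    (hne : G.normalLine i j ≠ G.normalLine (!i) j) :
    (G.normalLine i j : Set E3) ∩ G.normalLine (!i) j = {center (G.w j)} :=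
  inter_lines_eq_singleton (center_mem_normalLine hw i) (center_mem_normalLine hw (!i)) hne

lemma normal_eq_of_plane (h : G.Nonsingular) {j : Bool} (hw : c0 (G.w j) = 0) (i : Bool) :
    G.n (!i) j = G.n i j := by
  have e := (G.contact i j).normal_sub_normal (G.contact (!i) j) (h.2 j)
  rw [hw, zero_div, zero_smul, sub_eq_zero] at e
  exact e.symm

lemma normalLine_swap (i j : Bool) : G.swap.normalLine j i = G.normalLine i j := by
  rw [normalLine, normalLine, x_swap, n_swap]

end ContactGrid

/-! ### From a patch to its contact grid. -/

namespace IsSphereTriple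

variable {P : Submodule ℝ LieSpace} {s : Fin 3 → LieSpace}

lemma lieForm_self (h : IsSphereTriple P s) (k : Fin 3) : lieForm (s k) (s k) = 0 :=
  (h.1 k).2.2

lemma prod_lieForm_neg (hP : IsCyclidicPlane P) (h : IsSphereTriple P s) :
    lieForm (s 1) (s 2) * lieForm (s 0) (s 2) * lieForm (s 0) (s 1) < 0 := by
  obtain ⟨D, hD⟩ := hP.exists_gram_eq_neg_sq (fun k => (h.1 k).1) h.lieForm_self
  have hne (k l : Fin 3) (hkl : k ≠ l) : lieForm (s k) (s l) ≠ 0 :=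
    hP.lieForm_ne_zero (h.1 k).1 (h.1 l).1 (h.lieForm_self k) (h.lieForm_self l) (h.2 k l hkl)
  refine lt_of_le_of_ne ?_ (mul_ne_zero (mul_ne_zero (hne 1 2 (by decide)) (hne 0 2 (by decide)))
    (hne 0 1 (by decide)))
  linarith [sq_nonneg D]

lemma lieForm_familyParam_self (h : IsSphereTriple P s) (p : ℝ) :
    lieForm (familyParam s p) (familyParam s p) = 0 := by
  rw [← blossom_self, lieForm_blossom_blossom h.lieForm_self]
  ring

lemma lieForm_blossom_familyParam (h : IsSphereTriple P s) (u : Bool → ℝ) (i : Bool) :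
    lieForm (blossom s (u false) (u true)) (familyParam s (u i)) = 0 := by
  rw [← blossom_self, lieForm_blossom_blossom h.lieForm_self]
  cases i <;> ring

lemma lieForm_familyParam (h : IsSphereTriple P s) (u : Bool → ℝ) (i : Bool) :
    lieForm (familyParam s (u i)) (familyParam s (u (!i))) =
      -2 * lieForm (blossom s (u false) (u true)) (blossom s (u false) (u true)) := by
  rw [← blossom_self, ← blossom_self, lieForm_blossom_blossom h.lieForm_self,
    lieForm_blossom_blossom h.lieForm_self]
  cases i <;> simp only [Bool.not_false, Bool.not_true] <;> ring

lemma lieForm_blossom_pos (hP : IsCyclidicPlane P) (h : IsSphereTriple P s) {p q : ℝ}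
    (hpq : p < q) : 0 < lieForm (blossom s p q) (blossom s p q) := by
  rw [lieForm_blossom_blossom h.lieForm_self]
  have h1 := mul_pos (neg_pos.2 (prod_lieForm_neg hP h)) (pow_pos (sub_pos.2 hpq) 2)
  linear_combination h1 / 2

end IsSphereTriple

/-- The inward unit tangent at an end point of an arc of contact with `w`. -/
lemma inward_smul_unit_deriv (s : Fin 3 → LieSpace) {w : LieSpace} {u : Bool → ℝ}
    (hu : u false < u true) {i : Bool} (h : FiniteContact (familyParam s (u i)) w) :
    Patch.inward i • Patch.unit (deriv (fun p => contactPoint (familyParam s p) w) (u i)) =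
      (cr w / c0 (contactVec (familyParam s (u i)) w) *
          |cr w / c0 (contactVec (familyParam s (u i)) w)|⁻¹) •
        Patch.unit (tangentPart (blossom s (u false) (u true))
          (contactPoint (familyParam s (u i)) w) (contactNormal (familyParam s (u i)) w)) := by
  have hne : u i ≠ u (!i) := by cases i <;> simp [hu.ne, hu.ne']
  have hb : blossom s (u i) (u (!i)) = blossom s (u false) (u true) := by
    cases i
    · rfl
    · exact blossom_comm _ _ _
  have hd := hasDerivAt_contactPoint (hasDerivAt_familyParam s hne) rfl h
  rw [hd.deriv, hb, unit_smul, smul_smul, mul_inv_abs_mul, ← mul_assoc]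
  -- With the other end as second parameter, the factor 2/(q − p) of the derivative has the sign
  -- `inward i`, so orientation into the arc cancels it.
  have hsign : Patch.inward i * (2 / (u (!i) - u i) * |2 / (u (!i) - u i)|⁻¹) = 1 := by
    cases i
    · simp only [Patch.inward, Bool.not_false, Bool.false_eq_true, if_false, one_mul]
      exact mul_inv_abs_of_pos (div_pos two_pos (sub_pos.2 hu))
    · simp only [Patch.inward, Bool.not_true, if_true]
      have hneg : 2 / (u false - u true) < 0 := div_neg_of_pos_of_neg two_pos (sub_neg.2 hu)
      rw [abs_of_neg hneg, inv_neg, mul_neg, mul_inv_cancel₀ hneg.ne]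
      norm_num
  rw [hsign, one_mul]

namespace Patch

variable (F : Patch)

lemma lieForm_eq_zero {s w : LieSpace} (hs : s ∈ F.cyclide.P₁) (hw : w ∈ F.cyclide.P₂) :
    lieForm s w = 0 := by
  rw [F.cyclide.polar] at hw
  exact hw s hs

lemma blossom_mem₁ (p q : ℝ) : blossom F.s₁ p q ∈ F.cyclide.P₁ :=
  blossom_mem (fun k => (F.triple₁.1 k).1) p q

lemma blossom_mem₂ (p q : ℝ) : blossom F.s₂ p q ∈ F.cyclide.P₂ :=
  blossom_mem (fun k => (F.triple₂.1 k).1) p q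

lemma sphere_mem₁ (p : ℝ) : F.sphere₁ p ∈ F.cyclide.P₁ := by
  rw [sphere₁, ← blossom_self]
  exact F.blossom_mem₁ p p

lemma sphere_mem₂ (p : ℝ) : F.sphere₂ p ∈ F.cyclide.P₂ := by
  rw [sphere₂, ← blossom_self]
  exact F.blossom_mem₂ p p

variable {F}

/-- The contact grid of the boundary spheres of a patch. -/
noncomputable def grid (hfin : F.FiniteVertices) : ContactGrid where
  s i := F.sphere₁ (F.u i)
  w j := F.sphere₂ (F.v j)
  b := blossom F.s₁ (F.u false) (F.u true)
  d := blossom F.s₂ (F.v false) (F.v true)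
  contact i j := ⟨F.triple₁.lieForm_familyParam_self _, F.triple₂.lieForm_familyParam_self _,
    F.lieForm_eq_zero (F.sphere_mem₁ _) (F.sphere_mem₂ _), hfin i j⟩
  b_s i := F.triple₁.lieForm_blossom_familyParam F.u i
  b_w j := F.lieForm_eq_zero (F.blossom_mem₁ _ _) (F.sphere_mem₂ _)
  d_s i := by rw [lieForm_comm, F.lieForm_eq_zero (F.sphere_mem₁ _) (F.blossom_mem₂ _ _)]
  d_w j := F.triple₂.lieForm_blossom_familyParam F.v j
  b_d := F.lieForm_eq_zero (F.blossom_mem₁ _ _) (F.blossom_mem₂ _ _)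
  b_pos := F.triple₁.lieForm_blossom_pos F.cyclide.cyclidic₁ F.u_lt
  d_pos := F.triple₂.lieForm_blossom_pos F.cyclide.cyclidic₂ F.v_lt
  s_s i := F.triple₁.lieForm_familyParam F.u i
  w_w j := F.triple₂.lieForm_familyParam F.v j

variable (hfin : F.FiniteVertices)

lemma tangent₁_eq (i j : Bool) : F.tangent₁ i j = (grid hfin).tangent i j :=
  inward_smul_unit_deriv F.s₁ F.u_lt ((grid hfin).contact i j)

lemma tangent₂_eq (i j : Bool) : F.tangent₂ i j = (grid hfin).swap.tangent j i := by
  have h := inward_smul_unit_deriv F.s₂ F.v_lt ((grid hfin).swap.contact j i)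
  refine Eq.trans ?_ h
  rw [tangent₂]
  congr 4
  funext q
  exact contactPoint_comm _ _

lemma frame_eq (i j : Bool) : F.frame i j = (grid hfin).frame i j := by
  rw [frame, tangent₁_eq hfin, tangent₂_eq hfin]
  rfl

end Patch

end Cyclidic

/-! ### Assembly of the main theorem. -/

open Cyclidic
theorem mainTheorem4 (F : Patch) (hfin : F.FiniteVertices) :
    -- the four vertices lie on a circle
    Concircular {F.vertex false false, F.vertex true false,
      F.vertex true true, F.vertex false true} ∧
    (F.NonsingularVertices →
      -- the vertices are distinct and the vertex frames are orthonormal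
      ((Function.Injective fun p : Bool × Bool => F.vertex p.1 p.2) ∧
        ∀ i j, Orthonormal ℝ (F.frame i j)) ∧
      -- frames at vertices which are neighbours in the first direction
      (∀ i j,
        (¬ Separated (F.vertex i j) (F.vertex (!i) j) (F.vertex i (!j)) (F.vertex (!i) (!j)) →
          F.frame (!i) j = reflectFrame (F.vertex i j) (F.vertex (!i) j) (F.frame i j)) ∧
        (Separated (F.vertex i j) (F.vertex (!i) j) (F.vertex i (!j)) (F.vertex (!i) (!j)) →
          F.frame (!i) j =
            reflectFrame (F.vertex i j) (F.vertex (!i) j) (flip₂ (F.frame i j)) ∧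
          F.frame (!i) j =
            flip₂ (reflectFrame (F.vertex i j) (F.vertex (!i) j) (F.frame i j)))) ∧
      -- frames at vertices which are neighbours in the second direction
      (∀ i j,
        (¬ Separated (F.vertex i j) (F.vertex i (!j)) (F.vertex (!i) j) (F.vertex (!i) (!j)) →
          F.frame i (!j) = reflectFrame (F.vertex i j) (F.vertex i (!j)) (F.frame i j)) ∧
        (Separated (F.vertex i j) (F.vertex i (!j)) (F.vertex (!i) j) (F.vertex (!i) (!j)) →
          F.frame i (!j) =
            reflectFrame (F.vertex i j) (F.vertex i (!j)) (flip₁ (F.frame i j)) ∧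
          F.frame i (!j) =
            flip₁ (reflectFrame (F.vertex i j) (F.vertex i (!j)) (F.frame i j)))) ∧
      -- embedded vertex quadrilateral: no reversal along any of the four sides
      (EmbeddedQuad (F.vertex false false) (F.vertex true false)
          (F.vertex true true) (F.vertex false true) →
        ∀ i j,
          F.frame (!i) j = reflectFrame (F.vertex i j) (F.vertex (!i) j) (F.frame i j) ∧
          F.frame i (!j) = reflectFrame (F.vertex i j) (F.vertex i (!j)) (F.frame i j)) ∧
      -- non-embedded vertex quadrilateral: reversal along exactly one pair of opposite sides
      (¬ EmbeddedQuad (F.vertex false false) (F.vertex true false)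
          (F.vertex true true) (F.vertex false true) →
        (∀ i j,
          F.frame (!i) j =
            flip₂ (reflectFrame (F.vertex i j) (F.vertex (!i) j) (F.frame i j)) ∧
          F.frame i (!j) = reflectFrame (F.vertex i j) (F.vertex i (!j)) (F.frame i j)) ∨
        (∀ i j,
          F.frame (!i) j = reflectFrame (F.vertex i j) (F.vertex (!i) j) (F.frame i j) ∧
          F.frame i (!j) =
            flip₁ (reflectFrame (F.vertex i j) (F.vertex i (!j)) (F.frame i j)))) ∧
      -- normal lines at neighbours meet in the centre of the boundary sphere; if the boundary
      -- sphere is a plane, they are parallel with equal normals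
      (∀ i j,
        (c0 (F.boundarySphere₁ j) ≠ 0 →
          center (F.boundarySphere₁ j) ∈ F.normalLine i j ∧
          center (F.boundarySphere₁ j) ∈ F.normalLine (!i) j ∧
          (F.normalLine i j ≠ F.normalLine (!i) j →
            (F.normalLine i j : Set E3) ∩ F.normalLine (!i) j =
              {center (F.boundarySphere₁ j)})) ∧
        (c0 (F.boundarySphere₁ j) = 0 → F.vertexNormal (!i) j = F.vertexNormal i j)) ∧
      (∀ i j,
        (c0 (F.boundarySphere₂ i) ≠ 0 →
          center (F.boundarySphere₂ i) ∈ F.normalLine i j ∧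
          center (F.boundarySphere₂ i) ∈ F.normalLine i (!j) ∧
          (F.normalLine i j ≠ F.normalLine i (!j) →
            (F.normalLine i j : Set E3) ∩ F.normalLine i (!j) =
              {center (F.boundarySphere₂ i)})) ∧
        (c0 (F.boundarySphere₂ i) = 0 → F.vertexNormal i (!j) = F.vertexNormal i j))) := by
  set G := Patch.grid hfin with hG
  have hx : ∀ i j, F.vertex i j = G.x i j := fun _ _ => rfl
  have hframe : ∀ i j, F.frame i j = G.frame i j := Patch.frame_eq hfin
  refine ⟨G.concircular, fun hns => ?_⟩
  have h : G.Nonsingular := ⟨fun i => (hns i false).1, fun j => (hns false j).2⟩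
  simp only [hx, hframe]
  have hs0 (i : Bool) : cr (G.s i) * cr (G.s (!i)) ≠ 0 := mul_ne_zero (h.1 _) (h.1 _)
  have hw0 (j : Bool) : cr (G.w j) * cr (G.w (!j)) ≠ 0 := mul_ne_zero (h.2 _) (h.2 _)
  have hpos {r : ℝ} (hr : r ≠ 0) (hr' : ¬ r < 0) : 0 < r := lt_of_le_of_ne (not_lt.1 hr') hr.symm
  -- `EmbeddedQuad` lists the vertices cyclically, whereas the grid criterion lists opposite sides
  -- in parallel; `separated_comm` reconciles the orders.
  have sep₁ : Separated (G.x false false) (G.x true false) (G.x true true) (G.x false true) ↔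
      cr (G.s false) * cr (G.s true) < 0 := by
    rw [separated_comm]
    exact G.separated_iff h false false
  have sep₂ : Separated (G.x true false) (G.x true true) (G.x false true) (G.x false false) ↔
      cr (G.w false) * cr (G.w true) < 0 := by
    rw [separated_comm]
    exact G.separated_swap_iff h true false
  have hs (i : Bool) : cr (G.s i) * cr (G.s (!i)) = cr (G.s false) * cr (G.s true) := by
    cases i
    · rfl
    · exact mul_comm _ _
  have hw (j : Bool) : cr (G.w j) * cr (G.w (!j)) = cr (G.w false) * cr (G.w true) := by
    cases j
    · rfl
    · exact mul_comm _ _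
  refine ⟨⟨G.injective_x h, G.orthonormal_frame h⟩, fun i j => ⟨fun hsep => ?_, fun hsep => ?_⟩,
    fun i j => ⟨fun hsep => ?_, fun hsep => ?_⟩, fun hemb i j => ?_, fun hemb => ?_,
    fun i j => ⟨fun hc => ⟨?_, ?_, fun hne => ?_⟩, fun hc => ?_⟩,
    fun i j => ⟨fun hc => ⟨?_, ?_, fun hne => ?_⟩, fun hc => ?_⟩⟩
  · rw [G.separated_iff h] at hsep
    exact G.frame_left_of_pos h j (hpos (hs0 i) hsep)
  · rw [G.separated_iff h] at hsep
    rw [reflectFrame_flip₂]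
    exact ⟨G.frame_left_of_neg h j hsep, G.frame_left_of_neg h j hsep⟩
  · rw [G.separated_swap_iff h] at hsep
    exact G.frame_right_of_pos h i (hpos (hw0 j) hsep)
  · rw [G.separated_swap_iff h] at hsep
    rw [reflectFrame_flip₁]
    exact ⟨G.frame_right_of_neg h i hsep, G.frame_right_of_neg h i hsep⟩
  · rw [EmbeddedQuad, sep₁, sep₂, ← hs i, ← hw j] at hemb
    exact ⟨G.frame_left_of_pos h j (hpos (hs0 i) hemb.1),
      G.frame_right_of_pos h i (hpos (hw0 j) hemb.2)⟩
  · rw [EmbeddedQuad, sep₁, sep₂, not_and_or, not_not, not_not] at hemb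
    have hboth := G.not_both_neg h
    rcases hemb with hneg | hneg
    · left
      intro i j
      have hw' : ¬ cr (G.w j) * cr (G.w (!j)) < 0 := fun hj => hboth ⟨hneg, hw j ▸ hj⟩
      rw [← hs i] at hneg
      exact ⟨G.frame_left_of_neg h j hneg, G.frame_right_of_pos h i (hpos (hw0 j) hw')⟩
    · right
      intro i j
      have hs' : ¬ cr (G.s i) * cr (G.s (!i)) < 0 := fun hi => hboth ⟨hs i ▸ hi, hneg⟩
      rw [← hw j] at hneg
      exact ⟨G.frame_left_of_pos h j (hpos (hs0 i) hs'), G.frame_right_of_neg h i hneg⟩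
  · exact G.center_mem_normalLine hc i
  · exact G.center_mem_normalLine hc (!i)
  · exact G.normalLine_inter hc i hne
  · exact G.normal_eq_of_plane h hc i
  · have := G.swap.center_mem_normalLine hc j
    rw [G.normalLine_swap] at this
    exact this
  · have := G.swap.center_mem_normalLine hc (!j)
    rw [G.normalLine_swap] at this
    exact this
  · have := G.swap.normalLine_inter hc j
    rw [G.normalLine_swap, G.normalLine_swap] at this
    exact this hne
  · have := G.swap.normal_eq_of_plane h.swap hc j
    rw [G.n_swap, G.n_swap] at this
    exact this
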